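/- Let $\zeta:\mathbb{R}\to\mathbb{R}$ be nonnegative, even and integrable with $\int_{\mathbb{R}}\zeta=1$, and suppose that its Fourier transform $\hat\zeta(s)=\int_{\mathbb{R}}e^{-isx}\zeta(x)\,dx$ satisfies $\hat\zeta(s)>0$ and $\hat\zeta(s)\le C(1+|s|)^{-1/2-\eta}$ for all $s\in\mathbb{R}$, with some constants $C$ and $\eta>0$. For $\epsilon>0$ put $R(x;\epsilon)=\frac1\epsilon\zeta\left(\frac x\epsilon\right)$, and let $R(\cdot\,;0)=\delta$ be the Dirac mass at the origin; write $R_\epsilon * f$ for the convolution over $\mathbb{R}$ of $R(\cdot\,;\epsilon)$ with a periodic function $f$ (so $R_0*f=f$). Let $k>0$, $V_0\in\mathbb{R}$, and $$\beta(k;\epsilon)=\int_{\mathbb{R}}R(x;\epsilon)\cos(2kx)\,dx\quad(\beta(k;0)=1),\qquad A=-\frac{V_0}{\beta(k;\epsilon)},\qquad \omega=\frac{V_0+k^2}{2}+B-\frac{V_0}{2\beta(k;\epsilon)} .$$ Consider the Gross--Pitaevskii equation $$i\partial_t\psi=-\tfrac12\partial_x^2\psi+\psi\,\bigl(R_\epsilon*|\psi|^2\bigr)+V_0\sin^2(kx)\,\psi$$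 (nonlocal for $\epsilon>0$, local for $\epsilon=0$) and its solution $\psi(x,t)=(u(x)+iv(x))e^{-i\omega t}$ with $u(x)=\sqrt B\cos(kx)$, $v(x)=\sqrt{B+A}\,\sin(kx)$, where $B\ge0$. For $n\in\mathbb{N}$, $n\ge1$, let $S_T$ be the circle of circumference $T=2\pi n/k$, and let $JL$ be the linearization about this solution (in the frame rotating with frequency $\omega$, written in real and imaginary parts): the operator on $L^2(S_T)\times L^2(S_T)$ (complex-valued functions) with domain $H^2(S_T)\times H^2(S_T)$ given by $$J=\begin{pmatrix}0&1\\-1&0\end{pmatrix},\qquad L\begin{pmatrix}w\\z\end{pmatrix}=\begin{pmatrix}Mw+2u\,R_\epsilon*(uw+vz)\\ Mz+2v\,R_\epsilon*(uw+vz)\end{pmatrix},\qquad Mf=-\tfrac12f''+V_0\sin^2(kx)f-\omega f+\bigl(R_\epsilon*(u^2+v^2)\bigr)f .$$ The solution is called spectrally stable with respect to perturbations of period $2\pi n/k$ if $\operatorname{Re}\lambda\le0$ for every $\lambda$ in the spectrum $\sigma(JL)$, and spectrally unstable otherwise. Theorem. If $A\ge 2.46\,k^2$, then for $B$ and $\epsilon$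 sufficiently small the solution is spectrally unstable with respect to perturbations of period $2\pi n/k$, for every $n\ge1$. Precisely: for every $\zeta$ and $k$ as above and every $A_1\in\mathbb{R}$ there is $\delta>0$ such that for all $V_0\in\mathbb{R}$, $0\le B<\delta$ and $0\le\epsilon<\delta$ with $2.46\,k^2\le A\le A_1$, and for all integers $n\ge1$, the solution is spectrally unstable with respect to perturbations of period $2\pi n/k$. -/

import Mathlib

open MeasureTheory
open scoped ENNReal

namespace NonlocalGP

noncomputable section

/-! ### The interaction kernel -/

/-- The Fourier transform `∫ exp (-i s x) ζ x dx`. -/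
def fourierTransform (ζ : ℝ → ℝ) (s : ℝ) : ℂ :=
  ∫ x : ℝ, Complex.exp (-(Complex.I * s * x)) * (ζ x : ℂ)

/-- The admissible kernel profiles: nonnegative, even, of unit mass, with a positive Fourier
transform which decays faster than `|s| ^ (-1/2)`.  (The transform of an even real function is
real, so positivity is positivity of its real part.) -/
structure IsKernelProfile (ζ : ℝ → ℝ) : Prop where
  nonneg : ∀ x, 0 ≤ ζ x
  even : ∀ x, ζ (-x) = ζ x
  integrable : Integrable ζ
  integral_eq_one : ∫ x, ζ x = 1
  fourier_pos : ∀ s, 0 < (fourierTransform ζ s).re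
  fourier_decay : ∃ C η : ℝ, 0 < η ∧
    ∀ s, (fourierTransform ζ s).re ≤ C * (1 + |s|) ^ (-(1 / 2 : ℝ) - η)

/-- The rescaled kernel `R(x; ε) = ζ (x / ε) / ε`, used for `ε > 0`. -/
def kernel (ζ : ℝ → ℝ) (ε x : ℝ) : ℝ := 1 / ε * ζ (x / ε)

/-- `β(k; ε) = ∫ R(x; ε) cos (2 k x) dx`; for `ε = 0`, where the kernel is the Dirac mass at the
origin, it is `1`. -/
def beta (ζ : ℝ → ℝ) (k ε : ℝ) : ℝ :=
  if ε = 0 then 1 else ∫ x : ℝ, kernel ζ ε x * Real.cos (2 * k * x)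

/-- The amplitude `A = -V₀ / β(k; ε)` (with `α = 1`). -/
def amplitude (ζ : ℝ → ℝ) (k V₀ ε : ℝ) : ℝ := -V₀ / beta ζ k ε

/-- The frequency `ω = (V₀ + k²) / 2 + B - V₀ / (2 β(k; ε))` of the solution (with `α = 1`). -/
def frequency (ζ : ℝ → ℝ) (k V₀ B ε : ℝ) : ℝ :=
  (V₀ + k ^ 2) / 2 + B - V₀ / (2 * beta ζ k ε)

/-! ### Periodic functions -/

/-- The period `2 π n / k` of the perturbations. -/
def period (k : ℝ) (n : ℕ) : ℝ := 2 * Real.pi * n / k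

instance fact_period_pos (k : ℝ) [hk : Fact (0 < k)] (n : ℕ) [NeZero n] :
    Fact (0 < period k n) :=
  ⟨div_pos (mul_pos Real.two_pi_pos (Nat.cast_pos.mpr (Nat.pos_of_neZero n))) hk.out⟩

/-- The circle of circumference `2 π n / k`. -/
abbrev Circ (k : ℝ) (n : ℕ) : Type := AddCircle (period k n)

/-- Complex-valued square integrable functions on the circle of circumference `2 π n / k`. -/
abbrev L2 (k : ℝ) [Fact (0 < k)] (n : ℕ) [NeZero n] : Type :=
  Lp ℂ 2 (AddCircle.haarAddCircle : Measure (Circ k n))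

variable {k : ℝ} [hk : Fact (0 < k)] {n : ℕ} [NeZero n]

theorem mul_period (k : ℝ) [hk : Fact (0 < k)] (n : ℕ) (x : ℝ) :
    k * (x + period k n) = k * x + n * (2 * Real.pi) := by
  have : k ≠ 0 := hk.out.ne'
  unfold period
  field_simp

/-- The function `x ↦ cos (k x)` on the circle. -/
def cosFun (k : ℝ) [Fact (0 < k)] (n : ℕ) : C(Circ k n, ℂ) where
  toFun := Function.Periodic.lift (f := fun x : ℝ => ((Real.cos (k * x) : ℝ) : ℂ)) (fun x => by
    simp only [mul_period, Real.cos_add_nat_mul_two_pi])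
  continuous_toFun := continuous_coinduced_dom.mpr (by
    change Continuous fun x : ℝ => ((Real.cos (k * x) : ℝ) : ℂ)
    fun_prop)

/-- The function `x ↦ sin (k x)` on the circle. -/
def sinFun (k : ℝ) [Fact (0 < k)] (n : ℕ) : C(Circ k n, ℂ) where
  toFun := Function.Periodic.lift (f := fun x : ℝ => ((Real.sin (k * x) : ℝ) : ℂ)) (fun x => by
    simp only [mul_period, Real.sin_add_nat_mul_two_pi])
  continuous_toFun := continuous_coinduced_dom.mpr (by
    change Continuous fun x : ℝ => ((Real.sin (k * x) : ℝ) : ℂ)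
    fun_prop)

/-- The product of a continuous function and a square integrable function on the circle. -/
def mulFun (a : C(Circ k n, ℂ)) (f : L2 k n) : L2 k n :=
  (ContinuousMap.toLp (E := ℂ) ∞ AddCircle.haarAddCircle ℂ a :
    Lp ℂ ∞ (AddCircle.haarAddCircle : Measure (Circ k n))) • f

/-- The translate `x ↦ f (x - y)` of a square integrable function on the circle. -/
def translate (y : ℝ) (f : L2 k n) : L2 k n :=
  Lp.compMeasurePreserving (fun x : Circ k n => x - (y : Circ k n))
    (measurePreserving_sub_right AddCircle.haarAddCircle (y : Circ k n)) f

/-- The translate `x ↦ g (x - y)` of a continuous function on the circle. -/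
def translateFun (y : ℝ) (g : C(Circ k n, ℂ)) : C(Circ k n, ℂ) :=
  g.comp ⟨fun x : Circ k n => x - (y : Circ k n), by fun_prop⟩

/-- The convolution `R(· ; ε) ∗ f = ∫ R(y; ε) f (· - y) dy` over the whole real line of the kernel
with a periodic square integrable function; for `ε = 0` it is `f`. -/
def conv (ζ : ℝ → ℝ) (ε : ℝ) (f : L2 k n) : L2 k n :=
  if ε = 0 then f else ∫ y : ℝ, (kernel ζ ε y : ℂ) • translate y f

/-- The convolution `R(· ; ε) ∗ g = ∫ R(y; ε) g (· - y) dy` over the whole real line of the kernel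
with a periodic continuous function; for `ε = 0` it is `g`. -/
def convFun (ζ : ℝ → ℝ) (ε : ℝ) (g : C(Circ k n, ℂ)) : C(Circ k n, ℂ) :=
  if ε = 0 then g else ∫ y : ℝ, (kernel ζ ε y : ℂ) • translateFun y g

/-- The wave number `2 π j / T = k j / n` of the `j`-th Fourier mode on the circle of
circumference `T = 2 π n / k`. -/
def waveNumber (k : ℝ) (n : ℕ) (j : ℤ) : ℝ := 2 * Real.pi * j / period k n

/-- Membership in the Sobolev space of order two on the circle. -/
def IsH2 (f : L2 k n) : Prop :=
  Summable fun j : ℤ => (1 + waveNumber k n j ^ 2) ^ 2 * ‖fourierCoeff f j‖ ^ 2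

/-- The second derivative of a function in the Sobolev space of order two, whose `j`-th Fourier
coefficient is `- (2 π j / T)²` times that of the function. -/
def secondDeriv (f : L2 k n) : L2 k n :=
  ∑' j : ℤ, (((-(waveNumber k n j ^ 2) : ℝ) : ℂ) * fourierCoeff f j) • fourierLp 2 j

/-! ### The linearization about the solution -/

/-- The real part `√B cos (k x)` of the profile of the solution. -/
def uSol (k : ℝ) [Fact (0 < k)] (n : ℕ) (B : ℝ) : C(Circ k n, ℂ) :=
  ((Real.sqrt B : ℝ) : ℂ) • cosFun k n

/-- The imaginary part `√(B + A) sin (k x)` of the profile of the solution. -/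
def vSol (ζ : ℝ → ℝ) (k : ℝ) [Fact (0 < k)] (n : ℕ) (V₀ B ε : ℝ) : C(Circ k n, ℂ) :=
  ((Real.sqrt (B + amplitude ζ k V₀ ε) : ℝ) : ℂ) • sinFun k n

/-- The potential `V₀ sin² (k x)`. -/
def potential (k : ℝ) [Fact (0 < k)] (n : ℕ) (V₀ : ℝ) : C(Circ k n, ℂ) :=
  (V₀ : ℂ) • sinFun k n ^ 2

/-- The part of the linearization acting diagonally on real and imaginary parts:
`-(1/2) f'' + V f - ω f + (R ∗ (u² + v²)) f`. -/
def diagPart (ζ : ℝ → ℝ) (V₀ B ε : ℝ) (f : L2 k n) : L2 k n :=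
  -((1 / 2 : ℂ) • secondDeriv f) + mulFun (potential k n V₀) f
    - ((frequency ζ k V₀ B ε : ℝ) : ℂ) • f
    + mulFun (convFun ζ ε (uSol k n B ^ 2 + vSol ζ k n V₀ B ε ^ 2)) f

/-- The convolution `R ∗ (u w + v z)`. -/
def convPart (ζ : ℝ → ℝ) (V₀ B ε : ℝ) (p : L2 k n × L2 k n) : L2 k n :=
  conv ζ ε (mulFun (uSol k n B) p.1 + mulFun (vSol ζ k n V₀ B ε) p.2)

/-- The self-adjoint operator `L` of the linearization, acting on pairs `(w, z)`. -/
def opL (ζ : ℝ → ℝ) (V₀ B ε : ℝ) (p : L2 k n × L2 k n) : L2 k n × L2 k n :=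
  (diagPart ζ V₀ B ε p.1 + (2 : ℂ) • mulFun (uSol k n B) (convPart ζ V₀ B ε p),
   diagPart ζ V₀ B ε p.2 + (2 : ℂ) • mulFun (vSol ζ k n V₀ B ε) (convPart ζ V₀ B ε p))

/-- The linearization `J L`, where `J (a, b) = (b, -a)`. -/
def opJL (ζ : ℝ → ℝ) (V₀ B ε : ℝ) (p : L2 k n × L2 k n) : L2 k n × L2 k n :=
  ((opL ζ V₀ B ε p).2, -(opL ζ V₀ B ε p).1)

/-- `lam` is in the resolvent set of the (unbounded) operator with the given domain and action:
the operator minus `lam` is a bijection of the domain onto the space, with bounded inverse. -/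
def IsResolventPoint {X : Type*} [NormedAddCommGroup X] [NormedSpace ℂ X]
    (dom : Set X) (op : X → X) (lam : ℂ) : Prop :=
  ∃ S : X →L[ℂ] X, (∀ g, S g ∈ dom ∧ op (S g) - lam • S g = g) ∧
    ∀ f ∈ dom, S (op f - lam • f) = f

/-- The spectrum of `J L` on the space of square integrable pairs of period `2 π n / k`, with the
pairs in the Sobolev space of order two as its domain. -/
def spectrumJL (ζ : ℝ → ℝ) (k : ℝ) [Fact (0 < k)] (V₀ B ε : ℝ) (n : ℕ) [NeZero n] : Set ℂ :=
  {lam | ¬ IsResolventPoint {p : L2 k n × L2 k n | IsH2 p.1 ∧ IsH2 p.2} (opJL ζ V₀ B ε) lam}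

/-- Spectral stability of the solution with respect to perturbations of period `2 π n / k`. -/
def SpectrallyStable (ζ : ℝ → ℝ) (k : ℝ) [Fact (0 < k)] (V₀ B ε : ℝ) (n : ℕ) [NeZero n] : Prop :=
  ∀ lam ∈ spectrumJL ζ k V₀ B ε n, lam.re ≤ 0

end

end NonlocalGP

namespace NonlocalGP

noncomputable section

/-! ### A pencil of coercive operators -/

section Abstract

open scoped RealInnerProductSpace

variable {H : Type*} [NormedAddCommGroup H] [InnerProductSpace ℝ H]

/-! Since `A β = -V₀`, the potential and the smoothed density add up to a constant, so the diagonal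
part of `L` is exactly `-∂²/2 - k²/2`. Perturbations of period `π/k` (wave numbers `2kj`) are
admissible on every circle of circumference `2πn/k` and are preserved by `L`; an unstable
eigenfunction among them serves all `n` at once.

On this space `L` respects parity, because `u` is even and `v` is odd. Call its restriction to (`w`
odd, `z` even) `L₊` and to (`w` even, `z` odd) `L₋`; `J` swaps the two blocks. Each block is coded
isometrically by one real sequence, with a sign `σ = 1` for `L₊` and `σ = -1` for `L₋`. The
eigenvalue problem becomes `L₊ x = t y`, `L₋ y = -t x`, that is, degeneracy of the pencil `L₋ + s
L₊⁻¹` at `s = t²`.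

The symbol `2k²j² - k²/2` is negative only at `j = 0`, and the convolution contributes a nonnegative
form. In `L₊` that form outweighs the negative mode because `A` is large compared with `k²`
(`coercive_core`, `sandwich_one_coercive`). In `L₋` the constant mode `e` has energy at most `-k²/2
+ B < 0`, and it is the only obstruction to coercivity (`sandwich_neg_one_coercive`). Hence the
pencil has a negative direction at `s = 0` and none for large `s`, and a crossing at some `s > 0`
gives the eigenvalue `t = √s > 0` (`exists_degenerate_pencil`).

To stay with bounded operators, `L₊` and `L₋` are flanked by the smoothing `(1 + j²)^(-1/2)`; the
eigenvectors regain `H²` regularity from the equation itself (`summable_weighted_sq`). -/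

theorem isUnit_of_coercive [CompleteSpace H] {T : H →L[ℝ] H} {c : ℝ} (hc : 0 < c)
    (hT : ∀ x, c * ‖x‖ ^ 2 ≤ ⟪T x, x⟫) : IsUnit T := by
  refine T.isUnit_of_forall_le_norm_inner_map (c := NNReal.mk c hc.le) hc fun x => ?_
  calc ‖x‖ ^ 2 * c = c * ‖x‖ ^ 2 := mul_comm _ _
    _ ≤ ⟪T x, x⟫ := hT x
    _ ≤ ‖⟪T x, x⟫‖ := Real.le_norm_self _

theorem apply_inverse_apply {T : H →L[ℝ] H} (hT : IsUnit T) (x : H) :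
    T (Ring.inverse T x) = x := by
  have := Ring.mul_inverse_cancel T hT
  simpa using congrArg (fun L : H →L[ℝ] H => L x) this

theorem inner_sq_le_of_nonneg {T : H →L[ℝ] H} (hsymm : ∀ x y, ⟪T x, y⟫ = ⟪x, T y⟫)
    (hT : ∀ x, 0 ≤ ⟪T x, x⟫) (x y : H) : ⟪T x, y⟫ ^ 2 ≤ ⟪T x, x⟫ * ⟪T y, y⟫ := by
  have key : ∀ t : ℝ, 0 ≤ ⟪T y, y⟫ * (t * t) + (2 * ⟪T x, y⟫) * t + ⟪T x, x⟫ := fun t => by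
    have := hT (x + t • y)
    simp only [map_add, map_smul, inner_add_left, inner_add_right, inner_smul_left,
      inner_smul_right, conj_trivial] at this
    have h2 : ⟪T y, x⟫ = ⟪T x, y⟫ := by rw [hsymm, real_inner_comm]
    rw [h2] at this
    linarith
  have := discrim_le_zero key
  unfold discrim at this
  linarith

/-- If `Fa` is coercive and `Fb` is coercive up to a rank one term along `e`, where its quadratic
form is negative, then the pencil `Fb + s • S Fa⁻¹ S` is degenerate for some `s > 0`. -/
theorem exists_degenerate_pencil [CompleteSpace H] {Fa Fb S : H →L[ℝ] H} {e : H} {θ c : ℝ}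
    (hc : 0 < c) (hθ : 0 < θ)
    (hFa : ∀ x y, ⟪Fa x, y⟫ = ⟪x, Fa y⟫) (hFb : ∀ x y, ⟪Fb x, y⟫ = ⟪x, Fb y⟫)
    (hS : ∀ x y, ⟪S x, y⟫ = ⟪x, S y⟫) (he : ‖e‖ = 1) (hSe : S e = e)
    (hca : ∀ x, c * ‖x‖ ^ 2 ≤ ⟪Fa x, x⟫) (hcb : ∀ x, c * ‖x‖ ^ 2 ≤ ⟪Fb x, x⟫ + θ * ⟪e, x⟫ ^ 2)
    (hneg : ⟪Fb e, e⟫ < 0) :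
    ∃ s : ℝ, 0 < s ∧ ∃ η ξ : H, η ≠ 0 ∧ Fa ξ = S η ∧ Fb η = -(s • S ξ) := by
  have hFau := isUnit_of_coercive hc hca
  set Q : H →L[ℝ] H := Ring.inverse Fa
  have hQ : ∀ x, Fa (Q x) = x := apply_inverse_apply hFau
  have hFa0 : ∀ x, 0 ≤ ⟪Fa x, x⟫ := fun x => le_trans (by positivity) (hca x)
  have hee : ⟪e, e⟫ = 1 := by rw [real_inner_self_eq_norm_sq, he]; norm_num
  have hSQS : ∀ x, ⟪S (Q (S x)), x⟫ = ⟪Fa (Q (S x)), Q (S x)⟫ := fun x => by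
    rw [hS, hQ, real_inner_comm]
  -- The pencil plus the rank one term `θ e ⊗ e` is coercive for all `s ≥ 0`, so it can be inverted
  -- along the whole half line.
  set G : ℝ → H →L[ℝ] H := fun s =>
    Fb + s • (S ∘L Q ∘L S) + θ • (innerSL ℝ e).smulRight e with hG
  have hGapp : ∀ s x, G s x = Fb x + s • S (Q (S x)) + (θ * ⟪e, x⟫) • e := fun s x => by
    simp [hG, smul_smul]
  have hGin : ∀ s x, ⟪G s x, x⟫ =
      ⟪Fb x, x⟫ + s * ⟪Fa (Q (S x)), Q (S x)⟫ + θ * ⟪e, x⟫ ^ 2 := fun s x => by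
    rw [hGapp, inner_add_left, inner_add_left, real_inner_smul_left, real_inner_smul_left, hSQS]
    ring
  have hGc : ∀ s, 0 ≤ s → ∀ x, c * ‖x‖ ^ 2 ≤ ⟪G s x, x⟫ := fun s hs x => by
    rw [hGin]
    have := mul_nonneg hs (hFa0 (Q (S x)))
    linarith [hcb x]
  have hGu : ∀ s, 0 ≤ s → IsUnit (G s) := fun s hs => isUnit_of_coercive hc (hGc s hs)
  have hGcont : Continuous G := by fun_prop
  set X : ℝ → H := fun s => Ring.inverse (G s) e with hX
  have hGX : ∀ s, 0 ≤ s → G s (X s) = e := fun s hs => apply_inverse_apply (hGu s hs) e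
  have hXcont : ContinuousOn X (Set.Ici 0) := fun s hs => by
    obtain ⟨u, hu⟩ := hGu s hs
    have h1 : ContinuousAt (fun s => Ring.inverse (G s)) s := by
      refine ContinuousAt.comp (f := G) (g := Ring.inverse) ?_ hGcont.continuousAt
      rw [← hu]
      exact NormedRing.inverse_continuousAt u
    exact (h1.clm_apply continuousAt_const).continuousWithinAt
  have hXne : ∀ s, 0 ≤ s → X s ≠ 0 := fun s hs h => by
    have := hGX s hs
    rw [h, map_zero] at this
    rw [← this] at he
    simp at he
  have hXpos : ∀ s, 0 ≤ s → 0 < ⟪e, X s⟫ := fun s hs => by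
    have := hGc s hs (X s)
    rw [hGX s hs] at this
    exact lt_of_lt_of_le (mul_pos hc (pow_pos (norm_pos_iff.mpr (hXne s hs)) 2)) this
  -- The pencil maps `X s` to `(1 - g s) e`, so `g s = 1` makes it degenerate; this scalar equation
  -- is solved by the intermediate value theorem.
  set g : ℝ → ℝ := fun s => θ * ⟪e, X s⟫ with hg
  have hgcont : ContinuousOn g (Set.Ici 0) :=
    continuousOn_const.mul (continuousOn_const.inner hXcont)
  have hg0 : 1 < g 0 := by
    have hsymm : ∀ x y, ⟪G 0 x, y⟫ = ⟪x, G 0 y⟫ := fun x y => by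
      simp only [hGapp, zero_smul, add_zero, inner_add_left, inner_add_right,
        real_inner_smul_left, real_inner_smul_right, hFb, real_inner_comm e]
      ring
    -- Cauchy–Schwarz for the form of `G 0` gives `1 ≤ ⟪e, X 0⟫ (⟪Fb e, e⟫ + θ)`, and the bracket is
    -- below `θ`.
    have h1 := inner_sq_le_of_nonneg hsymm
      (fun x => le_trans (by positivity) (hGc 0 le_rfl x)) (X 0) e
    have h2 := hGin 0 e
    rw [hGX 0 le_rfl, hee, h2, hee] at h1
    have h3 := hXpos 0 le_rfl
    change 1 < θ * ⟪e, X 0⟫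
    nlinarith [mul_pos h3 (neg_pos.mpr hneg)]
  -- At this value, Cauchy–Schwarz for `Fa` shows that the term `s₀ S Fa⁻¹ S` alone dominates `θ e ⊗
  -- e`, so the pencil is nonnegative on `X s₀`.
  set s₀ := θ * ⟪Fa e, e⟫ with hs₀
  have hs₀' : 0 ≤ s₀ := mul_nonneg hθ.le (hFa0 e)
  have hgs₀ : g s₀ ≤ 1 := by
    have h1 := inner_sq_le_of_nonneg hFa hFa0 (Q (S (X s₀))) e
    rw [hQ, hS, hSe, ← hQ (S (X s₀)), hQ, real_inner_comm] at h1
    have h2 := hGin s₀ (X s₀)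
    rw [hGX s₀ hs₀'] at h2
    have h3 := hcb (X s₀)
    have h4 : 0 ≤ c * ‖X s₀‖ ^ 2 := by positivity
    have h5 := hXpos s₀ hs₀'
    have h6 : θ * ⟪e, X s₀⟫ ^ 2 ≤ s₀ * ⟪Fa (Q (S (X s₀))), Q (S (X s₀))⟫ := by
      rw [hs₀, hQ, mul_assoc]
      refine mul_le_mul_of_nonneg_left ?_ hθ.le
      linarith
    change θ * ⟪e, X s₀⟫ ≤ 1
    by_contra! h
    nlinarith
  obtain ⟨s, ⟨hs, -⟩, hgs⟩ :=
    intermediate_value_Icc' hs₀' (hgcont.mono Set.Icc_subset_Ici_self) ⟨hgs₀, hg0.le⟩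
  have hs' : 0 < s := lt_of_le_of_ne hs fun h => by rw [← h] at hgs; linarith
  refine ⟨s, hs', X s, Q (S (X s)), hXne s hs, hQ _, ?_⟩
  have := hGX s hs
  rw [hGapp] at this
  rw [show θ * ⟪e, X s⟫ = 1 from hgs, one_smul, add_eq_right] at this
  exact eq_neg_of_add_eq_zero_left this

end Abstract

/-! ### Operators on square summable sequences -/

section Sequences

open scoped RealInnerProductSpace

/-- Square summable real sequences indexed by the integers. -/
abbrev SqSeq : Type := lp (fun _ : ℤ => ℝ) 2

theorem memℓp_two_iff {f : ℤ → ℝ} : Memℓp f 2 ↔ Summable fun j => f j ^ 2 := by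
  rw [memℓp_gen_iff (by norm_num)]
  simp

theorem SqSeq.summable_sq (x : SqSeq) : Summable fun j => x j ^ 2 := memℓp_two_iff.mp (lp.memℓp x)

theorem SqSeq.norm_sq (x : SqSeq) : ‖x‖ ^ 2 = ∑' j, x j ^ 2 := by
  rw [← real_inner_self_eq_norm_sq, lp.inner_eq_tsum]
  simp [sq]

theorem SqSeq.smul_apply (t : ℝ) (x : SqSeq) (j : ℤ) : (t • x) j = t * x j := rfl

/-- Multiplication by a bounded sequence. -/
def diagOp (d : ℤ → ℝ) (M : ℝ) (hd : ∀ j, |d j| ≤ M) : SqSeq →L[ℝ] SqSeq :=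
  have h : ∀ (x : SqSeq) j, (d j * x j) ^ 2 ≤ M ^ 2 * x j ^ 2 := fun x j => by
    rw [mul_pow]
    exact mul_le_mul_of_nonneg_right (sq_le_sq' (by linarith [neg_abs_le (d j), hd j])
      ((le_abs_self _).trans (hd j))) (sq_nonneg _)
  have hs : ∀ x : SqSeq, Summable fun j => (d j * x j) ^ 2 := fun x =>
    Summable.of_nonneg_of_le (fun _ => sq_nonneg _) (h x) (x.summable_sq.mul_left _)
  LinearMap.mkContinuous
    { toFun := fun x => ⟨fun j => d j * x j, memℓp_two_iff.mpr (hs x)⟩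
      map_add' := fun x y => by
        ext j
        exact mul_add _ _ _
      map_smul' := fun t x => by
        ext j
        exact mul_left_comm _ _ _ } M fun x => by
      have hM : 0 ≤ M := (abs_nonneg _).trans (hd 0)
      refine le_of_sq_le_sq ?_ (by positivity)
      rw [mul_pow, SqSeq.norm_sq, SqSeq.norm_sq, ← tsum_mul_left]
      exact (hs x).tsum_le_tsum (h x) (x.summable_sq.mul_left _)

@[simp]
theorem diagOp_apply (d : ℤ → ℝ) (M : ℝ) (hd : ∀ j, |d j| ≤ M) (x : SqSeq) (j : ℤ) :
    diagOp d M hd x j = d j * x j := rfl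

/-- Reindexing by a permutation of the integers. -/
def permOp (σ : Equiv.Perm ℤ) : SqSeq →L[ℝ] SqSeq :=
  LinearMap.mkContinuous
    { toFun := fun x => ⟨fun j => x (σ j),
        memℓp_two_iff.mpr ((σ.summable_iff (f := fun j => x j ^ 2)).mpr x.summable_sq)⟩
      map_add' := fun _ _ => rfl
      map_smul' := fun _ _ => rfl } 1 fun x => by
      refine le_of_sq_le_sq ?_ (by positivity)
      rw [one_mul, SqSeq.norm_sq, SqSeq.norm_sq]
      exact (σ.tsum_eq fun j => x j ^ 2).le

@[simp]
theorem permOp_apply (σ : Equiv.Perm ℤ) (x : SqSeq) (j : ℤ) : permOp σ x j = x (σ j) := rfl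

theorem inner_diagOp (d : ℤ → ℝ) (M : ℝ) (hd : ∀ j, |d j| ≤ M) (x y : SqSeq) :
    ⟪diagOp d M hd x, y⟫ = ⟪x, diagOp d M hd y⟫ := by
  rw [lp.inner_eq_tsum, lp.inner_eq_tsum]
  refine tsum_congr fun j => ?_
  change y j * (d j * x j) = d j * y j * x j
  ring

theorem inner_permOp (σ : Equiv.Perm ℤ) (x y : SqSeq) :
    ⟪permOp σ x, y⟫ = ⟪x, permOp σ.symm y⟫ := by
  rw [lp.inner_eq_tsum, lp.inner_eq_tsum, ← σ.tsum_eq fun j => ⟪x j, permOp σ.symm y j⟫]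
  refine tsum_congr fun j => ?_
  rw [permOp_apply, permOp_apply, Equiv.symm_apply_apply]

theorem inner_diagOp_self (d : ℤ → ℝ) (M : ℝ) (hd : ∀ j, |d j| ≤ M) (x : SqSeq) :
    HasSum (fun j => d j * x j ^ 2) ⟪diagOp d M hd x, x⟫ := by
  have h := (lp.hasSum_inner (𝕜 := ℝ) (diagOp d M hd x) x)
  have h2 : (fun j => d j * x j ^ 2) = fun j => ⟪diagOp d M hd x j, x j⟫ := by
    funext j
    change _ = x j * (d j * x j)
    ring
  rwa [h2]

/-- The hopping operator between the even and the odd modes. -/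
def hopOp (a b σ : ℝ) : SqSeq →L[ℝ] SqSeq :=
  a • (ContinuousLinearMap.id ℝ SqSeq - σ • permOp (Equiv.subLeft (-1))) +
    (σ * b) • (permOp (Equiv.neg ℤ) - σ • permOp (Equiv.addRight 1))

/-- The adjoint of the hopping operator. -/
def hopAdj (a b σ : ℝ) : SqSeq →L[ℝ] SqSeq :=
  a • (ContinuousLinearMap.id ℝ SqSeq - σ • permOp (Equiv.subLeft (-1))) +
    (σ * b) • (permOp (Equiv.neg ℤ) - σ • permOp (Equiv.addRight (-1)))

theorem hopOp_apply (a b σ : ℝ) (x : SqSeq) (j : ℤ) :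
    hopOp a b σ x j = a * (x j - σ * x (-1 - j)) + σ * b * (x (-j) - σ * x (j + 1)) := rfl

theorem hopAdj_apply (a b σ : ℝ) (x : SqSeq) (j : ℤ) :
    hopAdj a b σ x j = a * (x j - σ * x (-1 - j)) + σ * b * (x (-j) - σ * x (j - 1)) := rfl

theorem inner_hopOp (a b σ : ℝ) (x y : SqSeq) :
    ⟪hopOp a b σ x, y⟫ = ⟪x, hopAdj a b σ y⟫ := by
  have h1 : ⟪permOp (Equiv.subLeft (-1)) x, y⟫ = ⟪x, permOp (Equiv.subLeft (-1)) y⟫ := by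
    rw [inner_permOp]
    congr 1
    ext j
    simp [sub_eq_add_neg, add_comm]
  have h2 : ⟪permOp (Equiv.neg ℤ) x, y⟫ = ⟪x, permOp (Equiv.neg ℤ) y⟫ := by
    rw [inner_permOp]
    rfl
  have h3 : ⟪permOp (Equiv.addRight 1) x, y⟫ = ⟪x, permOp (Equiv.addRight (-1)) y⟫ := by
    rw [inner_permOp]
    rfl
  simp only [hopOp, hopAdj, _root_.add_apply, _root_.smul_apply, _root_.sub_apply,
    ContinuousLinearMap.id_apply, inner_add_left, inner_add_right,
    inner_sub_left, inner_sub_right, real_inner_smul_left, real_inner_smul_right, h1, h2, h3]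

/-- The weights `(1 + j²)^(-1/2)`. -/
def weight (j : ℤ) : ℝ := (Real.sqrt (1 + (j : ℝ) ^ 2))⁻¹

theorem weight_pos (j : ℤ) : 0 < weight j := by
  unfold weight
  positivity

theorem weight_sq (j : ℤ) : weight j ^ 2 = (1 + (j : ℝ) ^ 2)⁻¹ := by
  rw [weight, inv_pow, Real.sq_sqrt (by positivity)]

theorem abs_weight_le (j : ℤ) : |weight j| ≤ 1 := by
  rw [abs_of_pos (weight_pos j)]
  exact inv_le_one_of_one_le₀ (Real.one_le_sqrt.mpr (by nlinarith [sq_nonneg (j : ℝ)]))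

/-- The smoothing operator with symbol `(1 + j²)^(-1/2)`. -/
def smoothOp : SqSeq →L[ℝ] SqSeq := diagOp weight 1 abs_weight_le

@[simp]
theorem smoothOp_apply (x : SqSeq) (j : ℤ) : smoothOp x j = weight j * x j := rfl

/-- The symbol `2 k² j² - k² / 2` of `-(1/2) ∂² - k² / 2` at the wave number `2 j k`. -/
def symbol (k : ℝ) (j : ℤ) : ℝ := 2 * k ^ 2 * (j : ℝ) ^ 2 - k ^ 2 / 2

theorem symbol_mul_weight_sq (k : ℝ) (j : ℤ) :
    symbol k j * weight j ^ 2 = 2 * k ^ 2 - 5 / 2 * k ^ 2 * (1 + (j : ℝ) ^ 2)⁻¹ := by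
  rw [weight_sq, symbol]
  field_simp
  ring

theorem abs_symbol_mul_weight_sq_le (k : ℝ) (j : ℤ) :
    |symbol k j * weight j ^ 2| ≤ 2 * k ^ 2 := by
  have h1 : 0 ≤ (1 + (j : ℝ) ^ 2)⁻¹ := by positivity
  have h2 : (1 + (j : ℝ) ^ 2)⁻¹ ≤ 1 := inv_le_one_of_one_le₀ (by nlinarith [sq_nonneg (j : ℝ)])
  rw [symbol_mul_weight_sq, abs_le]
  constructor <;> nlinarith [sq_nonneg k, mul_nonneg (sq_nonneg k) h1]

/-- The operator `S (m + h* r h / 2) S`, where `S` is the smoothing operator, `m` the symbol of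
`-(1/2) ∂² - k² / 2`, `h` the hopping operator and `r` the symbol of the convolution. -/
def sandwich (k a b σ : ℝ) (r : ℤ → ℝ) (hr : ∀ j, |Real.sqrt (r j)| ≤ 1) : SqSeq →L[ℝ] SqSeq :=
  diagOp (fun j => symbol k j * weight j ^ 2) (2 * k ^ 2) (abs_symbol_mul_weight_sq_le k) +
    (1 / 2 : ℝ) • ((smoothOp ∘L hopAdj a b σ ∘L diagOp _ 1 hr) ∘L
      (diagOp _ 1 hr ∘L hopOp a b σ ∘L smoothOp))

theorem abs_sqrt_le_one {r : ℤ → ℝ} (hr1 : ∀ j, r j ≤ 1) (j : ℤ) : |Real.sqrt (r j)| ≤ 1 := by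
  rw [abs_of_nonneg (Real.sqrt_nonneg _)]
  exact Real.sqrt_le_one.mpr (hr1 j)

section Sandwich

variable {k a b σ : ℝ} {r : ℤ → ℝ} {hr : ∀ j, |Real.sqrt (r j)| ≤ 1}

/-- Splitting `r` as `√r √r` turns the convolution term into a Gram form, from which both symmetry
and nonnegativity can be read off. -/
theorem inner_sandwich (x y : SqSeq) :
    ⟪sandwich k a b σ r hr x, y⟫ =
      ⟪diagOp (fun j => symbol k j * weight j ^ 2) (2 * k ^ 2)
        (abs_symbol_mul_weight_sq_le k) x, y⟫ +
      1 / 2 * ⟪diagOp _ 1 hr (hopOp a b σ (smoothOp x)),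
        diagOp _ 1 hr (hopOp a b σ (smoothOp y))⟫ := by
  have h1 : ∀ u : SqSeq, ⟪smoothOp (hopAdj a b σ (diagOp _ 1 hr u)), y⟫ =
      ⟪u, diagOp _ 1 hr (hopOp a b σ (smoothOp y))⟫ := fun u => by
    rw [smoothOp, inner_diagOp weight, real_inner_comm, ← inner_hopOp, real_inner_comm,
      inner_diagOp]
  rw [← h1, sandwich, _root_.add_apply, inner_add_left, _root_.smul_apply, real_inner_smul_left]
  rfl

theorem sandwich_symm (x y : SqSeq) :
    ⟪sandwich k a b σ r hr x, y⟫ = ⟪x, sandwich k a b σ r hr y⟫ := by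
  rw [inner_sandwich, ← real_inner_comm x, inner_sandwich, inner_diagOp, real_inner_comm,
    real_inner_comm (diagOp _ 1 hr _)]

/-- The output lives on the wave numbers `k(2j + 1)`, where `j ↦ -1 - j` is the reflection `x ↦ -x`;
each parity block of pairs yields a function `uw + vz` of definite parity. -/
theorem hopOp_reflect (hσ : σ * σ = 1) (x : SqSeq) (j : ℤ) :
    hopOp a b σ x (-1 - j) = -(σ * hopOp a b σ x j) := by
  rw [hopOp_apply, hopOp_apply, sub_sub_cancel, show -(-1 - j) = j + 1 by ring,
    show -1 - j + 1 = -j by ring]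
  linear_combination -(a * x (-1 - j) + σ * b * x (j + 1)) * hσ

/-- The action of the sequence operator `m + h* r h / 2`. -/
def seqL (k a b σ : ℝ) (r x : ℤ → ℝ) (j : ℤ) : ℝ :=
  symbol k j * x j +
    (a * (r j * (a * (x j - σ * x (-1 - j)) + σ * b * (x (-j) - σ * x (j + 1)))) -
      b * (r (j - 1) *
        (a * (x (j - 1) - σ * x (-j)) + σ * b * (x (1 - j) - σ * x j))))

/-- The reflection symmetry identifies the four terms of the adjoint in pairs; this is the factor
`2` that the `1 / 2` in `sandwich` removes. -/
theorem hopAdj_hopOp_apply (hσ : σ * σ = 1) (hr0 : ∀ j, 0 ≤ r j) (hrs : ∀ j, r (-1 - j) = r j)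
    (x : SqSeq) (j : ℤ) :
    hopAdj a b σ (diagOp _ 1 hr (diagOp _ 1 hr (hopOp a b σ x))) j =
      2 * (seqL k a b σ r x j - symbol k j * x j) := by
  have h0 : ∀ i, diagOp _ 1 hr (diagOp _ 1 hr (hopOp a b σ x)) i = r i * hopOp a b σ x i :=
    fun i => by rw [diagOp_apply, diagOp_apply, ← mul_assoc, Real.mul_self_sqrt (hr0 i)]
  have h1 : hopOp a b σ x (-j) = -(σ * hopOp a b σ x (j - 1)) := by
    rw [← hopOp_reflect hσ, show -1 - (j - 1) = -j by ring]
  have h2 : r (-j) = r (j - 1) := by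
    rw [← hrs (j - 1), show -1 - (j - 1) = -j by ring]
  rw [hopAdj_apply, h0, h0, h0, h0, hrs, h2, hopOp_reflect hσ, h1, seqL]
  have h3 : hopOp a b σ x (j - 1) =
      a * (x (j - 1) - σ * x (-j)) + σ * b * (x (1 - j) - σ * x j) := by
    rw [hopOp_apply, show -1 - (j - 1) = -j by ring, show -(j - 1) = 1 - j by ring,
      sub_add_cancel]
  rw [h3, hopOp_apply]
  linear_combination (a * r j * (a * (x j - σ * x (-1 - j)) + σ * b * (x (-j) - σ * x (j + 1))) -
    b * r (j - 1) * (a * (x (j - 1) - σ * x (-j)) + σ * b * (x (1 - j) - σ * x j))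
      - b * r (j - 1) * (a * (x (j - 1) - σ * x (-j)) + σ * b * (x (1 - j) - σ * x j))) * hσ

theorem sandwich_apply (hσ : σ * σ = 1) (hr0 : ∀ j, 0 ≤ r j) (hrs : ∀ j, r (-1 - j) = r j)
    (x : SqSeq) (j : ℤ) :
    sandwich k a b σ r hr x j = weight j * seqL k a b σ r (smoothOp x) j := by
  have h : sandwich k a b σ r hr x j = symbol k j * weight j ^ 2 * x j + 1 / 2 * (weight j *
      hopAdj a b σ (diagOp _ 1 hr (diagOp _ 1 hr (hopOp a b σ (smoothOp x)))) j) := rfl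
  rw [h, hopAdj_hopOp_apply (k := k) hσ hr0 hrs, smoothOp_apply]
  ring

end Sandwich

end Sequences

/-! ### Coercivity of the two parity blocks and the resulting eigenvector -/

section Sequences

open scoped RealInnerProductSpace

/-- This is the contest on the modes `0, ±1`: either the convolution term `t` is large, or `c x` is
close to `a y + b z` and the modes `±1` pay for the negative mode `0`. -/
theorem coercive_core {k a b c r x y z : ℝ} (hk : 0 < k) (hc : 2.46 * k ^ 2 ≤ c ^ 2)
    (hr : 1 / 2 ≤ r) (hab : a + b = c) (hab2 : a ^ 2 + b ^ 2 ≤ 2 / 3 * c ^ 2) :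
    0 ≤ -(5 / 8 * k ^ 2) * x ^ 2 + 5 / 4 * k ^ 2 * (y ^ 2 + z ^ 2) +
      r * (a * (x - y) + b * (x - z)) ^ 2 := by
  set t := a * (x - y) + b * (x - z) with ht
  have hk2 : 0 < k ^ 2 := by positivity
  have hc2 : 0 < c ^ 2 := by nlinarith
  -- The Young weights `3/2` and `3` are tuned so that `5/8 · 3 · 2/3 = 5/4` uses up the `y, z` term
  -- exactly; the `t` term then needs only `r c² ≥ 15/16 k²`.
  have h1 : (c * x) ^ 2 ≤ 3 / 2 * t ^ 2 + 3 * (a * y + b * z) ^ 2 := by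
    have : c * x = t + (a * y + b * z) := by rw [ht, ← hab]; ring
    rw [this]
    nlinarith [sq_nonneg (t - 2 * (a * y + b * z))]
  have h2 : (a * y + b * z) ^ 2 ≤ 2 / 3 * c ^ 2 * (y ^ 2 + z ^ 2) := by
    have : (a * y + b * z) ^ 2 ≤ (a ^ 2 + b ^ 2) * (y ^ 2 + z ^ 2) := by
      nlinarith [sq_nonneg (a * z - b * y)]
    exact this.trans (mul_le_mul_of_nonneg_right hab2 (by positivity))
  have h3 : 15 / 16 * k ^ 2 * t ^ 2 ≤ c ^ 2 * (r * t ^ 2) := by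
    have : 15 / 16 * k ^ 2 ≤ c ^ 2 * r := by nlinarith
    calc _ ≤ c ^ 2 * r * t ^ 2 := mul_le_mul_of_nonneg_right this (sq_nonneg t)
      _ = _ := by ring
  have h4 : 0 ≤ c ^ 2 * (-(5 / 8 * k ^ 2) * x ^ 2 + 5 / 4 * k ^ 2 * (y ^ 2 + z ^ 2) +
      r * t ^ 2) := by
    have := mul_le_mul_of_nonneg_left (h1.trans (add_le_add_right
      (mul_le_mul_of_nonneg_left h2 (by norm_num : (0 : ℝ) ≤ 3)) _)) hk2.le
    nlinarith
  exact nonneg_of_mul_nonneg_right h4 hc2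

theorem symbol_mul_weight_sq_ge {k : ℝ} {j : ℤ} (hj : j ≠ 0) :
    3 / 4 * k ^ 2 ≤ symbol k j * weight j ^ 2 := by
  have h1 : (1 : ℝ) ≤ (j : ℝ) ^ 2 := by
    exact_mod_cast Int.add_one_le_iff.mpr (by positivity : (0 : ℤ) < j ^ 2)
  have h2 : (1 + (j : ℝ) ^ 2)⁻¹ ≤ 1 / 2 := by
    rw [inv_le_comm₀ (by positivity) (by positivity)]
    linarith
  rw [symbol_mul_weight_sq]
  nlinarith [sq_nonneg k]

theorem symbol_mul_weight_sq_zero (k : ℝ) : symbol k 0 * weight 0 ^ 2 = -(k ^ 2 / 2) := by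
  rw [symbol_mul_weight_sq]
  push_cast
  ring

theorem weight_zero : weight 0 = 1 := by simp [weight]

variable {k a b c : ℝ} {r : ℤ → ℝ} {hr : ∀ j, |Real.sqrt (r j)| ≤ 1}

theorem sandwich_one_coercive (hk : 0 < k) (hc : 2.46 * k ^ 2 ≤ c ^ 2)
    (hr0 : 1 / 2 ≤ r 0) (hrs : ∀ j, r (-1 - j) = r j) (hab : a + b = c)
    (hab2 : a ^ 2 + b ^ 2 ≤ 2 / 3 * c ^ 2) (x : SqSeq) :
    k ^ 2 / 8 * ‖x‖ ^ 2 ≤ ⟪sandwich k a b 1 r hr x, x⟫ := by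
  rw [inner_sandwich, real_inner_self_eq_norm_sq, SqSeq.norm_sq, SqSeq.norm_sq]
  have hd := inner_diagOp_self _ _ (abs_symbol_mul_weight_sq_le k) x
  have hs := (hd.sub (x.summable_sq.hasSum.mul_left (k ^ 2 / 8)))
  -- Outside these three modes the symbol alone already exceeds `k² / 8`.
  have h1 : ∑ j ∈ {-1, 0, 1}, (symbol k j * weight j ^ 2 * x j ^ 2 - k ^ 2 / 8 * x j ^ 2) ≤ _ :=
    sum_le_hasSum {-1, 0, 1} (fun j hj => by
      have hj0 : j ≠ 0 := by rintro rfl; simp at hj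
      nlinarith [symbol_mul_weight_sq_ge (k := k) hj0, sq_nonneg (x j), sq_nonneg k,
        mul_nonneg (sub_nonneg.mpr (symbol_mul_weight_sq_ge (k := k) hj0)) (sq_nonneg (x j)),
        mul_nonneg (sq_nonneg k) (sq_nonneg (x j))]) hs
  set N := hopOp a b 1 (smoothOp x) with hN
  -- These indices are the wave numbers `∓k`; by reflection they contribute equally, which cancels
  -- the factor `1 / 2` of the convolution term.
  have h2 : ∑ j ∈ {-1, 0}, (diagOp _ 1 hr N j) ^ 2 ≤ _ :=
    (SqSeq.summable_sq (diagOp _ 1 hr N)).sum_le_tsum {-1, 0} fun _ _ => sq_nonneg _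
  set X := x 0
  set Y := weight (-1) * x (-1) with hY
  set Z := weight 1 * x 1 with hZ
  have hw : weight 1 ^ 2 = 1 / 2 := by rw [weight_sq]; norm_num
  have hw' : weight (-1) ^ 2 = 1 / 2 := by rw [weight_sq]; norm_num
  have hY2 : Y ^ 2 = 1 / 2 * x (-1) ^ 2 := by rw [hY, mul_pow, hw']
  have hZ2 : Z ^ 2 = 1 / 2 * x 1 ^ 2 := by rw [hZ, mul_pow, hw]
  have hN0 : N 0 = a * (X - Y) + b * (X - Z) := by
    rw [hN, hopOp_apply]
    simp only [smoothOp_apply, neg_zero, sub_zero, zero_add, weight_zero]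
    ring
  have hN1 : N (-1) = -(a * (X - Y) + b * (X - Z)) := by
    have := hopOp_reflect (a := a) (b := b) (σ := 1) (by norm_num) (smoothOp x) 0
    rw [sub_zero, ← hN, one_mul, hN0] at this
    exact this
  have hr1 : r (-1) = r 0 := by rw [← hrs 0, sub_zero]
  rw [Finset.sum_pair (by norm_num), diagOp_apply, diagOp_apply, hN0, hN1, hr1, mul_pow, mul_pow,
    neg_sq, Real.sq_sqrt (by linarith)] at h2
  rw [Finset.sum_insert (by norm_num), Finset.sum_pair (by norm_num), symbol_mul_weight_sq_zero,
    hw, hw'] at h1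
  have h3 := coercive_core (x := X) (y := Y) (z := Z) hk hc hr0 hab hab2
  rw [hY2, hZ2] at h3
  have hs1 : symbol k 1 = 3 / 2 * k ^ 2 := by rw [symbol]; push_cast; ring
  have hs2 : symbol k (-1) = 3 / 2 * k ^ 2 := by rw [symbol]; push_cast; ring
  rw [hs1, hs2] at h1
  linarith

/-- The convolution form is simply dropped: the rank one term lifts the only negative symbol value
from `-k²/2` to `k²/2`. -/
theorem sandwich_neg_one_coercive (x : SqSeq) :
    k ^ 2 / 8 * ‖x‖ ^ 2 ≤ ⟪sandwich k a b (-1) r hr x, x⟫ +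
      k ^ 2 * ⟪(lp.single 2 0 (1 : ℝ) : SqSeq), x⟫ ^ 2 := by
  have he : ⟪(lp.single 2 0 (1 : ℝ) : SqSeq), x⟫ = x 0 := by
    rw [lp.inner_single_left]
    simp
  rw [inner_sandwich, real_inner_self_eq_norm_sq, SqSeq.norm_sq, he]
  have hd := inner_diagOp_self _ _ (abs_symbol_mul_weight_sq_le k) x
  have hs := (hd.sub (x.summable_sq.hasSum.mul_left (k ^ 2 / 8)))
  have h1 : ∑ j ∈ {0}, (symbol k j * weight j ^ 2 * x j ^ 2 - k ^ 2 / 8 * x j ^ 2) ≤ _ :=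
    sum_le_hasSum {0} (fun j hj => by
      have hj0 : j ≠ 0 := by rintro rfl; simp at hj
      nlinarith [mul_nonneg (sub_nonneg.mpr (symbol_mul_weight_sq_ge (k := k) hj0))
        (sq_nonneg (x j)), mul_nonneg (sq_nonneg k) (sq_nonneg (x j))]) hs
  rw [Finset.sum_singleton, symbol_mul_weight_sq_zero] at h1
  nlinarith [sq_nonneg ‖diagOp _ 1 hr (hopOp a b (-1) (smoothOp x))‖,
    mul_nonneg (sq_nonneg k) (sq_nonneg (x 0))]

theorem seqL_smul (σ t : ℝ) (x : ℤ → ℝ) (j : ℤ) :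
    seqL k a b σ r (fun i => t * x i) j = t * seqL k a b σ r x j := by
  unfold seqL
  ring

/-- Elliptic regularity: the convolution part is bounded on square summable sequences, so the
equation itself controls `j² x j`. -/
theorem summable_weighted_sq {σ : ℝ} (hk : 0 < k) (hσ : σ * σ = 1) (hr0 : ∀ j, 0 ≤ r j)
    (hr1 : ∀ j, r j ≤ 1) (hrs : ∀ j, r (-1 - j) = r j) (x y : SqSeq)
    (h : ∀ j, seqL k a b σ r x j = y j) :
    Summable fun j : ℤ => ((1 + (j : ℝ) ^ 2) * x j) ^ 2 := by
  have hr := abs_sqrt_le_one hr1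
  -- Dividing the symbol by `2k²` gives `j² - 1/4`; adding `5/4` produces the weight `1 + j²`.
  set z : SqSeq := (2 * k ^ 2)⁻¹ • (y - (1 / 2 : ℝ) •
    hopAdj a b σ (diagOp _ 1 hr (diagOp _ 1 hr (hopOp a b σ x)))) + (5 / 4 : ℝ) • x
  refine (SqSeq.summable_sq z).congr fun j => ?_
  congr 1
  have : z j = (2 * k ^ 2)⁻¹ * (y j - 1 / 2 *
    hopAdj a b σ (diagOp _ 1 hr (diagOp _ 1 hr (hopOp a b σ x))) j) + 5 / 4 * x j := rfl
  rw [this, hopAdj_hopOp_apply (k := k) hσ hr0 hrs, h, symbol]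
  field_simp
  ring

/-- The eigenvalue problem for the linearization, in terms of Fourier coefficients, has a solution
with a positive eigenvalue. -/
theorem exists_eigenSequence (hk : 0 < k) (hc : 2.46 * k ^ 2 ≤ c ^ 2) (hab : a + b = c)
    (hab2 : (a - b) ^ 2 ≤ k ^ 2 / 4) (hr0 : ∀ j, 0 ≤ r j) (hr1 : ∀ j, r j ≤ 1)
    (hrs : ∀ j, r (-1 - j) = r j) (hr2 : 1 / 2 ≤ r 0) :
    ∃ t : ℝ, 0 < t ∧ ∃ x y : SqSeq, y ≠ 0 ∧
      (∀ j, seqL k a b 1 r x j = t * y j) ∧ (∀ j, seqL k a b (-1) r y j = -(t * x j)) ∧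
      (Summable fun j : ℤ => ((1 + (j : ℝ) ^ 2) * x j) ^ 2) ∧
      Summable fun j : ℤ => ((1 + (j : ℝ) ^ 2) * y j) ^ 2 := by
  have hr := abs_sqrt_le_one hr1
  have hk2 : 0 < k ^ 2 := by positivity
  set e : SqSeq := lp.single 2 0 (1 : ℝ)
  have he0 : ∀ j, j ≠ 0 → e j = 0 := fun j hj =>
    lp.single_apply_ne (E := fun _ : ℤ => ℝ) 2 0 (1 : ℝ) hj
  have he1 : e 0 = 1 := lp.single_apply_self (E := fun _ : ℤ => ℝ) 2 0 (1 : ℝ)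
  -- Here `a² + b² = (c² + (a - b)²) / 2`, so the claim amounts to `(a - b)² ≤ c² / 3`.
  have hab3 : a ^ 2 + b ^ 2 ≤ 2 / 3 * c ^ 2 := by
    rw [← hab] at hc ⊢
    nlinarith
  have hSe : smoothOp e = e := by
    ext j
    rw [smoothOp_apply]
    rcases eq_or_ne j 0 with rfl | hj
    · rw [weight_zero, one_mul]
    · rw [he0 j hj, mul_zero]
  have h1 : (1 : ℝ) * 1 = 1 := by norm_num
  have h2 : (-1 : ℝ) * -1 = 1 := by norm_num
  -- The value is `-k²/2 + r 0 (a - b)²`, at most `-k²/4`.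
  have hneg : ⟪sandwich k a b (-1) r hr e, e⟫ < 0 := by
    have h : ⟪sandwich k a b (-1) r hr e, e⟫ = sandwich k a b (-1) r hr e 0 := by
      rw [lp.inner_single_right]
      simp
    rw [h, sandwich_apply h2 hr0 hrs, weight_zero, one_mul, hSe, seqL]
    have h3 : r (0 - 1) = r 0 := by rw [← hrs 0, zero_sub, sub_zero]
    rw [h3, neg_zero, he1, he0 _ (by norm_num : (-1 - 0 : ℤ) ≠ 0),
      he0 _ (by norm_num : (0 + 1 : ℤ) ≠ 0), he0 _ (by norm_num : (0 - 1 : ℤ) ≠ 0),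
      he0 _ (by norm_num : (1 - 0 : ℤ) ≠ 0), symbol]
    have h4 := mul_le_mul_of_nonneg_right (hr1 0) (sq_nonneg (a - b))
    push_cast
    nlinarith
  -- With `P` the smoothing, `y = P η` and `L₊⁻¹ y = P ξ` turn `L₋ y = -s L₊⁻¹ y` into a problem for
  -- the flanked operators with `S = P²`.
  obtain ⟨s, hs, η, ξ, hη, hξ, hηξ⟩ := exists_degenerate_pencil (S := smoothOp ∘L smoothOp)
    (c := k ^ 2 / 8) (θ := k ^ 2) (by positivity) hk2
    (sandwich_symm (k := k) (a := a) (b := b) (σ := 1) (r := r) (hr := hr))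
    (sandwich_symm (k := k) (a := a) (b := b) (σ := -1) (r := r) (hr := hr))
    (fun x y => by
      simp only [smoothOp, ContinuousLinearMap.comp_apply, inner_diagOp])
    ((lp.norm_single (E := fun _ : ℤ => ℝ) (p := 2) (by norm_num) 0 1).trans norm_one)
    (by rw [ContinuousLinearMap.comp_apply, hSe, hSe])
    (sandwich_one_coercive hk hc hr2 hrs hab hab3) sandwich_neg_one_coercive hneg
  have hts : Real.sqrt s * Real.sqrt s = s := Real.mul_self_sqrt hs.le
  have ht : 0 < Real.sqrt s := Real.sqrt_pos.mpr hs
  set t := Real.sqrt s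
  have hX : ∀ j, seqL k a b 1 r (t • smoothOp ξ : SqSeq) j = t * smoothOp η j := fun j => by
    have h3 := congrArg (fun z : SqSeq => z j) hξ
    change sandwich k a b 1 r hr ξ j = weight j * (weight j * η j) at h3
    rw [sandwich_apply h1 hr0 hrs] at h3
    have h4 := mul_left_cancel₀ (weight_pos j).ne' h3
    exact (seqL_smul 1 t _ j).trans (congrArg (t * ·) h4)
  have hY : ∀ j, seqL k a b (-1) r (smoothOp η) j = -(t * (t • smoothOp ξ : SqSeq) j) := fun j => by
    have h3 := congrArg (fun z : SqSeq => z j) hηξ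
    change sandwich k a b (-1) r hr η j = -(s * (weight j * (weight j * ξ j))) at h3
    rw [sandwich_apply h2 hr0 hrs] at h3
    refine mul_left_cancel₀ (weight_pos j).ne' (h3.trans ?_)
    rw [SqSeq.smul_apply, smoothOp_apply, ← hts]
    ring
  refine ⟨t, ht, t • smoothOp ξ, smoothOp η, fun h => hη ?_, hX, hY,
    summable_weighted_sq hk h1 hr0 hr1 hrs _ (t • smoothOp η) hX,
    summable_weighted_sq hk h2 hr0 hr1 hrs _ (-(t • (t • smoothOp ξ))) hY⟩
  ext j
  have h3 := congrArg (fun z : SqSeq => z j) h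
  exact (mul_eq_zero.mp h3).resolve_left (weight_pos j).ne'

end Sequences

/-! ### The symbol of the convolution -/

/-- The real part of the Fourier transform of the kernel profile. -/
def kernelSymbol (ζ : ℝ → ℝ) (s : ℝ) : ℝ := (fourierTransform ζ s).re

theorem norm_fourierIntegrand (ζ : ℝ → ℝ) (s x : ℝ) :
    ‖Complex.exp (-(Complex.I * s * x)) * (ζ x : ℂ)‖ = ‖ζ x‖ := by
  rw [norm_mul, show -(Complex.I * s * x) = ((-(s * x) : ℝ) : ℂ) * Complex.I by push_cast; ring,
    Complex.norm_exp_ofReal_mul_I, one_mul, Complex.norm_real]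

section Profile

variable {ζ : ℝ → ℝ}

theorem aestronglyMeasurable_fourierIntegrand (hi : Integrable ζ) (s : ℝ) :
    AEStronglyMeasurable fun x : ℝ => Complex.exp (-(Complex.I * s * x)) * (ζ x : ℂ) :=
  (Continuous.aestronglyMeasurable (by fun_prop)).mul hi.ofReal.aestronglyMeasurable

theorem integrable_fourierIntegrand (hi : Integrable ζ) (s : ℝ) :
    Integrable fun x : ℝ => Complex.exp (-(Complex.I * s * x)) * (ζ x : ℂ) :=
  hi.congr' (aestronglyMeasurable_fourierIntegrand hi s)
    (Filter.Eventually.of_forall fun x => (norm_fourierIntegrand ζ s x).symm)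

theorem conj_fourierTransform (ζ : ℝ → ℝ) (s : ℝ) :
    (starRingEnd ℂ) (fourierTransform ζ s) = fourierTransform ζ (-s) := by
  rw [fourierTransform, ← integral_conj, fourierTransform]
  refine integral_congr_ae (Filter.Eventually.of_forall fun x => ?_)
  simp [← Complex.exp_conj]

theorem fourierTransform_neg (he : ∀ x, ζ (-x) = ζ x) (s : ℝ) :
    fourierTransform ζ (-s) = fourierTransform ζ s := by
  rw [fourierTransform, ← integral_neg_eq_self, fourierTransform]
  refine integral_congr_ae (Filter.Eventually.of_forall fun x => ?_)
  simp [he]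

theorem ofReal_kernelSymbol (he : ∀ x, ζ (-x) = ζ x) (s : ℝ) :
    (kernelSymbol ζ s : ℂ) = fourierTransform ζ s :=
  Complex.conj_eq_iff_re.mp (by rw [conj_fourierTransform, fourierTransform_neg he])

theorem kernelSymbol_neg (he : ∀ x, ζ (-x) = ζ x) (s : ℝ) :
    kernelSymbol ζ (-s) = kernelSymbol ζ s := by
  rw [kernelSymbol, fourierTransform_neg he, kernelSymbol]

theorem kernelSymbol_zero (h1 : ∫ x, ζ x = 1) : kernelSymbol ζ 0 = 1 := by
  have : fourierTransform ζ 0 = ((∫ x, ζ x : ℝ) : ℂ) := by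
    rw [← integral_complex_ofReal, fourierTransform]
    simp
  rw [kernelSymbol, this, h1]
  simp

theorem kernelSymbol_le_one (hζ : IsKernelProfile ζ) (s : ℝ) : kernelSymbol ζ s ≤ 1 := by
  refine (Complex.re_le_norm _).trans ((norm_integral_le_integral_norm _).trans ?_)
  simp only [norm_fourierIntegrand]
  rw [← hζ.integral_eq_one]
  exact le_of_eq (integral_congr_ae (Filter.Eventually.of_forall fun x =>
    Real.norm_of_nonneg (hζ.nonneg x)))

theorem continuous_kernelSymbol (hi : Integrable ζ) : Continuous (kernelSymbol ζ) := by
  refine Complex.continuous_re.comp (continuous_of_dominated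
    (aestronglyMeasurable_fourierIntegrand hi)
    (fun s => Filter.Eventually.of_forall fun x => (norm_fourierIntegrand ζ s x).le) hi.norm
    (Filter.Eventually.of_forall fun x => by fun_prop))

theorem integrable_kernel (hi : Integrable ζ) {ε : ℝ} (hε : 0 < ε) : Integrable (kernel ζ ε) :=
  (hi.comp_div hε.ne').const_mul _

/-- Rescaling by `ε` turns the frequency `w` into `ε w`; this makes the convolution a Fourier
multiplier. -/
theorem integral_kernel_mul_exp (he : ∀ x, ζ (-x) = ζ x) {ε : ℝ} (hε : 0 < ε) (w : ℝ) :
    ∫ y : ℝ, (kernel ζ ε y : ℂ) * Complex.exp (-(Complex.I * w * y)) = kernelSymbol ζ (ε * w) := by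
  rw [ofReal_kernelSymbol he, fourierTransform]
  have h := Measure.integral_comp_div
    (fun x : ℝ => Complex.exp (-(Complex.I * (ε * w : ℝ) * x)) * (ζ x : ℂ)) ε
  rw [abs_of_pos hε, Complex.real_smul] at h
  have hε' : (ε : ℂ) ≠ 0 := by exact_mod_cast hε.ne'
  refine mul_left_cancel₀ hε' ?_
  rw [← h, ← integral_const_mul]
  refine integral_congr_ae (Filter.Eventually.of_forall fun x => ?_)
  simp only [kernel]
  push_cast
  rw [show Complex.I * (ε * w) * (x / ε) = Complex.I * w * x by field_simp]
  field_simp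

theorem beta_eq_kernelSymbol (hζ : IsKernelProfile ζ) (k : ℝ) {ε : ℝ} (hε : 0 ≤ ε) :
    beta ζ k ε = kernelSymbol ζ (ε * (2 * k)) := by
  rcases hε.eq_or_lt with rfl | hε
  · rw [zero_mul, kernelSymbol_zero hζ.integral_eq_one, beta, if_pos rfl]
  · have h := congrArg Complex.re (integral_kernel_mul_exp hζ.even hε (2 * k))
    rw [Complex.ofReal_re] at h
    have hint : Integrable fun y : ℝ =>
        (kernel ζ ε y : ℂ) * Complex.exp (-(Complex.I * (2 * k : ℝ) * y)) := by
      simpa only [mul_comm] using integrable_fourierIntegrand (integrable_kernel hζ.integrable hε)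
        (2 * k)
    rw [beta, if_neg hε.ne', ← h, ← Complex.reCLM_apply,
      ← Complex.reCLM.integral_comp_comm hint]
    refine integral_congr_ae (Filter.Eventually.of_forall fun x => ?_)
    simp only [Complex.reCLM_apply, Complex.re_ofReal_mul]
    rw [show -(Complex.I * (2 * k : ℝ) * x) = ((-(2 * k * x) : ℝ) : ℂ) * Complex.I by
      push_cast; ring, Complex.exp_ofReal_mul_I_re, Real.cos_neg]

end Profile

/-! ### Fourier coefficients on the circle -/

section Circle

theorem fourier_circ_coe {k : ℝ} {n : ℕ} (i : ℤ) (x : ℝ) :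
    fourier i (x : Circ k n) = Complex.exp (Complex.I * waveNumber k n i * x) := by
  rw [fourier_coe_apply, waveNumber]
  congr 1
  push_cast
  ring

theorem fourier_sub_coe {k : ℝ} {n : ℕ} (i : ℤ) (x : Circ k n) (y : ℝ) :
    fourier i (x - (y : Circ k n)) = Complex.exp (-(Complex.I * waveNumber k n i * y)) *
      fourier i x := by
  have h : fourier i x = fourier i (x - (y : Circ k n)) * fourier i (y : Circ k n) := by
    simp only [fourier_apply, ← Circle.coe_mul, ← AddCircle.toCircle_add, ← smul_add,
      sub_add_cancel]
  rw [h, fourier_circ_coe, mul_left_comm, ← Complex.exp_add, neg_add_cancel, Complex.exp_zero,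
    mul_one]

variable {k : ℝ} [hk : Fact (0 < k)] {n : ℕ} [NeZero n]

theorem coeff_ext {f g : L2 k n} (h : ∀ i, fourierCoeff f i = fourierCoeff g i) : f = g := by
  refine fourierBasis.repr.injective (lp.ext (funext fun i => ?_))
  rw [fourierBasis_repr, fourierBasis_repr, h]

theorem coeff_eq_inner (f : L2 k n) (i : ℤ) :
    fourierCoeff f i = inner ℂ (fourierLp 2 i : L2 k n) f := by
  rw [← fourierBasis_repr, fourierBasis.repr_apply_apply, coe_fourierBasis]

theorem coeff_add (f g : L2 k n) (i : ℤ) :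
    fourierCoeff (f + g : L2 k n) i = fourierCoeff f i + fourierCoeff g i := by
  simp only [coeff_eq_inner, inner_add_right]

theorem coeff_sub (f g : L2 k n) (i : ℤ) :
    fourierCoeff (f - g : L2 k n) i = fourierCoeff f i - fourierCoeff g i := by
  simp only [coeff_eq_inner, inner_sub_right]

theorem coeff_neg (f : L2 k n) (i : ℤ) : fourierCoeff (-f : L2 k n) i = -fourierCoeff f i := by
  simp only [coeff_eq_inner, inner_neg_right]

theorem coeff_smul (t : ℂ) (f : L2 k n) (i : ℤ) :
    fourierCoeff (t • f : L2 k n) i = t * fourierCoeff f i := by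
  simp only [coeff_eq_inner, inner_smul_right]

theorem coeFn_mulFun (a : C(Circ k n, ℂ)) (f : L2 k n) :
    mulFun a f =ᵐ[AddCircle.haarAddCircle] fun x => a x * f x := by
  filter_upwards [Lp.coeFn_lpSMul (r := 2) (ContinuousMap.toLp (E := ℂ) ∞
    (AddCircle.haarAddCircle : Measure (Circ k n)) ℂ a :
    Lp ℂ ∞ (AddCircle.haarAddCircle : Measure (Circ k n))) f,
    ContinuousMap.coeFn_toLp (p := ∞) (𝕜 := ℂ)
      (AddCircle.haarAddCircle : Measure (Circ k n)) a] with x h1 h2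
  rw [mulFun, h1, Pi.smul_apply', h2, smul_eq_mul]

theorem mulFun_add (a b : C(Circ k n, ℂ)) (f : L2 k n) :
    mulFun (a + b) f = mulFun a f + mulFun b f := by
  refine Lp.ext ?_
  filter_upwards [coeFn_mulFun (a + b) f, coeFn_mulFun a f, coeFn_mulFun b f,
    Lp.coeFn_add (mulFun a f) (mulFun b f)] with x h1 h2 h3 h4
  rw [h1, h4, Pi.add_apply, h2, h3, ContinuousMap.add_apply, add_mul]

theorem mulFun_smul (t : ℂ) (a : C(Circ k n, ℂ)) (f : L2 k n) :
    mulFun (t • a) f = t • mulFun a f := by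
  refine Lp.ext ?_
  filter_upwards [coeFn_mulFun (t • a) f, coeFn_mulFun a f,
    Lp.coeFn_smul t (mulFun a f)] with x h1 h2 h3
  rw [h1, h3, Pi.smul_apply, h2, ContinuousMap.smul_apply, smul_eq_mul, smul_eq_mul, mul_assoc]

theorem mulFun_one (f : L2 k n) : mulFun (1 : C(Circ k n, ℂ)) f = f := by
  refine Lp.ext ?_
  filter_upwards [coeFn_mulFun (1 : C(Circ k n, ℂ)) f] with x h1
  rw [h1, ContinuousMap.one_apply, one_mul]

theorem coeff_mulFun_fourier (m : ℤ) (f : L2 k n) (i : ℤ) :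
    fourierCoeff (mulFun (fourier m) f) i = fourierCoeff f (i - m) := by
  refine integral_congr_ae ?_
  filter_upwards [coeFn_mulFun (fourier m) f] with x h
  simp only [h, smul_eq_mul]
  rw [← mul_assoc, ← fourier_add, neg_sub, sub_eq_neg_add]

theorem waveNumber_eq (j : ℤ) : waveNumber k n j = k * j / n := by
  have h1 : (n : ℝ) ≠ 0 := Nat.cast_ne_zero.mpr (NeZero.ne n)
  have h2 : k ≠ 0 := hk.out.ne'
  rw [waveNumber, period]
  field_simp

theorem waveNumber_neg (j : ℤ) : waveNumber k n (-j) = -waveNumber k n j := by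
  rw [waveNumber_eq, waveNumber_eq]
  push_cast
  ring

theorem waveNumber_mul (m : ℤ) : waveNumber k n (m * n) = k * m := by
  have h1 : (n : ℝ) ≠ 0 := Nat.cast_ne_zero.mpr (NeZero.ne n)
  rw [waveNumber_eq]
  push_cast
  field_simp

theorem coeff_translate (y : ℝ) (f : L2 k n) (i : ℤ) :
    fourierCoeff (translate y f) i =
      Complex.exp (-(Complex.I * waveNumber k n i * y)) * fourierCoeff f i := by
  have h1 : fourierCoeff (translate y f) i = ∫ x : Circ k n,
      Complex.exp (-(Complex.I * waveNumber k n i * y)) *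
        (fun z => fourier (-i) z * f z) (x - (y : Circ k n)) ∂AddCircle.haarAddCircle := by
    refine integral_congr_ae ?_
    filter_upwards [Lp.coeFn_compMeasurePreserving f
      (measurePreserving_sub_right AddCircle.haarAddCircle (y : Circ k n))] with x h
    rw [translate, h, Function.comp_apply, smul_eq_mul, fourier_sub_coe, waveNumber_neg,
      ← mul_assoc, ← mul_assoc, ← Complex.exp_add]
    push_cast
    rw [show -(Complex.I * (waveNumber k n i : ℂ) * y) +
      -(Complex.I * -(waveNumber k n i : ℂ) * y) = 0 by ring, Complex.exp_zero, one_mul]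
  rw [h1, integral_const_mul]
  exact congrArg _ (integral_sub_right_eq_self (μ := AddCircle.haarAddCircle)
    (fun z : Circ k n => fourier (-i) z * f z) (y : Circ k n))

/-- Supplies the measurability needed to take Fourier coefficients under the vector-valued integral
defining `conv`. -/
theorem continuous_translate (f : L2 k n) : Continuous fun y : ℝ => translate y f := by
  have hc : Continuous fun p : ℝ × Circ k n => p.2 - (p.1 : Circ k n) :=
    continuous_snd.sub ((AddCircle.continuous_mk' _).comp continuous_fst)
  exact Continuous.compMeasurePreservingLp (f := fun _ : ℝ => f)
    (g := (ContinuousMap.mk _ hc).curry) continuous_const (ContinuousMap.curry _).continuous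
    (fun y => measurePreserving_sub_right AddCircle.haarAddCircle (y : Circ k n)) (by norm_num)

theorem coeff_conv {ζ : ℝ → ℝ} (hζ : IsKernelProfile ζ) {ε : ℝ} (hε : 0 ≤ ε) (f : L2 k n)
    (i : ℤ) :
    fourierCoeff (conv ζ ε f) i = kernelSymbol ζ (ε * waveNumber k n i) * fourierCoeff f i := by
  rcases hε.eq_or_lt with rfl | hε
  · rw [zero_mul, kernelSymbol_zero hζ.integral_eq_one, conv, if_pos rfl]
    simp
  · have hint : Integrable fun y : ℝ => (kernel ζ ε y : ℂ) • translate y f := by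
      refine ((integrable_kernel hζ.integrable hε).norm.mul_const ‖f‖).mono'
        ((integrable_kernel hζ.integrable hε).ofReal.aestronglyMeasurable.fun_smul
          (continuous_translate f).aestronglyMeasurable)
        (Filter.Eventually.of_forall fun y => ?_)
      rw [norm_smul, Complex.norm_real, translate, Lp.norm_compMeasurePreserving]
    rw [conv, if_neg hε.ne', coeff_eq_inner, ← innerSL_apply_apply,
      ← (innerSL ℂ (fourierLp 2 i : L2 k n)).integral_comp_comm hint,
      ← integral_kernel_mul_exp hζ.even hε, ← integral_mul_const]
    refine integral_congr_ae (Filter.Eventually.of_forall fun y => ?_)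
    simp only [map_smul, innerSL_apply_apply, ← coeff_eq_inner, coeff_translate, smul_eq_mul,
      mul_assoc]

end Circle

/-! ### The linearization in terms of Fourier coefficients -/

section Linearization

variable {k : ℝ} [hk : Fact (0 < k)] {n : ℕ} [NeZero n]

theorem waveNumber_natCast : waveNumber k n n = k := by
  simpa using waveNumber_mul (k := k) (n := n) 1

theorem cosFun_eq : cosFun k n = (1 / 2 : ℂ) • (fourier (n : ℤ) + fourier (-(n : ℤ))) := by
  ext x
  induction x using QuotientAddGroup.induction_on with | _ x => ?_
  change ((Real.cos (k * x) : ℝ) : ℂ) =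
    (1 / 2 : ℂ) * (fourier (n : ℤ) (x : Circ k n) + fourier (-(n : ℤ)) (x : Circ k n))
  rw [fourier_circ_coe, fourier_circ_coe, waveNumber_neg, waveNumber_natCast, Complex.ofReal_cos,
    Complex.cos]
  push_cast
  ring_nf

theorem sinFun_eq : sinFun k n = (-Complex.I / 2) • (fourier (n : ℤ) - fourier (-(n : ℤ))) := by
  ext x
  induction x using QuotientAddGroup.induction_on with | _ x => ?_
  change ((Real.sin (k * x) : ℝ) : ℂ) =
    (-Complex.I / 2) * (fourier (n : ℤ) (x : Circ k n) - fourier (-(n : ℤ)) (x : Circ k n))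
  rw [fourier_circ_coe, fourier_circ_coe, waveNumber_neg, waveNumber_natCast, Complex.ofReal_sin,
    Complex.sin]
  push_cast
  ring_nf

/-- The function `2 cos (2 k x)` on the circle. -/
def doubleMode (k : ℝ) (n : ℕ) : C(Circ k n, ℂ) := fourier (2 * n : ℤ) + fourier (-(2 * n : ℤ))

theorem cosFun_sq : cosFun k n ^ 2 = (1 / 2 : ℂ) • 1 + (1 / 4 : ℂ) • doubleMode k n := by
  ext x
  have h1 : (fourier (2 * n : ℤ) : C(Circ k n, ℂ)) x = fourier (n : ℤ) x * fourier (n : ℤ) x := by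
    rw [two_mul, fourier_add]
  have h2 : (fourier (-(2 * n : ℤ)) : C(Circ k n, ℂ)) x =
      fourier (-(n : ℤ)) x * fourier (-(n : ℤ)) x := by
    rw [two_mul, neg_add, fourier_add]
  have h3 : (fourier (n : ℤ) : C(Circ k n, ℂ)) x * fourier (-(n : ℤ)) x = 1 := by
    rw [← fourier_add, add_neg_cancel, fourier_zero]
  simp only [cosFun_eq, doubleMode, ContinuousMap.pow_apply, ContinuousMap.smul_apply,
    ContinuousMap.add_apply, ContinuousMap.one_apply, smul_eq_mul, h1, h2]
  linear_combination (1 / 2 : ℂ) * h3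

theorem sinFun_sq : sinFun k n ^ 2 = (1 / 2 : ℂ) • 1 - (1 / 4 : ℂ) • doubleMode k n := by
  ext x
  have h1 : (fourier (2 * n : ℤ) : C(Circ k n, ℂ)) x = fourier (n : ℤ) x * fourier (n : ℤ) x := by
    rw [two_mul, fourier_add]
  have h2 : (fourier (-(2 * n : ℤ)) : C(Circ k n, ℂ)) x =
      fourier (-(n : ℤ)) x * fourier (-(n : ℤ)) x := by
    rw [two_mul, neg_add, fourier_add]
  have h3 : (fourier (n : ℤ) : C(Circ k n, ℂ)) x * fourier (-(n : ℤ)) x = 1 := by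
    rw [← fourier_add, add_neg_cancel, fourier_zero]
  simp only [sinFun_eq, doubleMode, ContinuousMap.pow_apply, ContinuousMap.smul_apply,
    ContinuousMap.add_apply, ContinuousMap.sub_apply, ContinuousMap.one_apply, smul_eq_mul, h1, h2]
  linear_combination (1 / 2 : ℂ) * h3 + (1 / 4 : ℂ) * (fourier (n : ℤ) x -
    fourier (-(n : ℤ)) x) ^ 2 * Complex.I_sq

variable {ζ : ℝ → ℝ}

theorem convFun_doubleMode (hζ : IsKernelProfile ζ) {ε : ℝ} (hε : 0 ≤ ε) (p q : ℂ) :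
    convFun ζ ε (p • 1 + q • doubleMode k n) = p • 1 + (q * beta ζ k ε) • doubleMode k n := by
  have hb := beta_eq_kernelSymbol hζ k hε
  rcases hε.eq_or_lt with rfl | hε
  · rw [convFun, if_pos rfl, hb, zero_mul, kernelSymbol_zero hζ.integral_eq_one]
    simp
  · have hw : waveNumber k n (2 * n) = 2 * k := by
      rw [waveNumber_mul]
      push_cast
      ring
    have htr : ∀ y : ℝ, (kernel ζ ε y : ℂ) • translateFun y (p • 1 + q • doubleMode k n) =
        ((kernel ζ ε y : ℂ) * Complex.exp (-(Complex.I * (0 : ℝ) * y))) •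
          (p • (1 : C(Circ k n, ℂ))) +
        (((kernel ζ ε y : ℂ) * Complex.exp (-(Complex.I * (2 * k : ℝ) * y))) •
          (q • fourier (2 * n : ℤ)) +
        ((kernel ζ ε y : ℂ) * Complex.exp (-(Complex.I * (-(2 * k) : ℝ) * y))) •
          (q • fourier (-(2 * n : ℤ)))) := fun y => by
      ext x
      simp only [translateFun, ContinuousMap.smul_apply, ContinuousMap.comp_apply,
        ContinuousMap.coe_mk, ContinuousMap.add_apply, doubleMode, fourier_sub_coe, smul_eq_mul,
        ContinuousMap.one_apply, waveNumber_neg, hw, Complex.ofReal_zero, mul_zero, zero_mul,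
        neg_zero, Complex.exp_zero]
      ring
    have hint : ∀ w : ℝ, Integrable fun y : ℝ =>
        (kernel ζ ε y : ℂ) * Complex.exp (-(Complex.I * w * y)) := fun w => by
      simpa only [mul_comm] using integrable_fourierIntegrand (integrable_kernel hζ.integrable hε) w
    rw [convFun, if_neg hε.ne', integral_congr_ae (Filter.Eventually.of_forall htr),
      integral_add ((hint _).smul_const _) (((hint _).smul_const _).add ((hint _).smul_const _)),
      integral_add ((hint _).smul_const _) ((hint _).smul_const _),
      integral_smul_const, integral_smul_const, integral_smul_const,
      integral_kernel_mul_exp hζ.even hε, integral_kernel_mul_exp hζ.even hε,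
      integral_kernel_mul_exp hζ.even hε, mul_zero, kernelSymbol_zero hζ.integral_eq_one, mul_neg,
      kernelSymbol_neg hζ.even, ← hb, doubleMode]
    simp only [Complex.ofReal_one, one_mul, smul_smul, smul_add, mul_comm q]

theorem coeff_secondDeriv {f : L2 k n} (hf : IsH2 f) (i : ℤ) :
    fourierCoeff (secondDeriv f) i = -(waveNumber k n i : ℂ) ^ 2 * fourierCoeff f i := by
  set c : ℤ → ℂ := fun i => ((-(waveNumber k n i ^ 2) : ℝ) : ℂ) * fourierCoeff f i with hc
  have hmem : Memℓp c 2 := by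
    rw [memℓp_gen_iff (by norm_num)]
    refine Summable.of_nonneg_of_le (fun i => by positivity) (fun i => ?_) hf
    simp only [hc, norm_mul, Complex.norm_real, norm_neg, norm_pow, Real.norm_eq_abs, sq_abs,
      ENNReal.toReal_ofNat, Real.rpow_ofNat, mul_pow]
    gcongr
    linarith
  have h1 := (fourierBasis (T := period k n)).hasSum_repr_symm ⟨c, hmem⟩
  rw [coe_fourierBasis] at h1
  have h2 : secondDeriv f = (fourierBasis (T := period k n)).repr.symm ⟨c, hmem⟩ := h1.tsum_eq
  rw [h2, ← fourierBasis_repr, LinearIsometryEquiv.apply_symm_apply]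
  simp [hc]

/-- The smoothing multiplies the `cos (2 k x)` part of the density by `β`, and `A β = -V₀` makes it
cancel against that of `V₀ sin²`. The constant left over is `ω - k²/2`. -/
theorem coeff_diagPart (hζ : IsKernelProfile ζ) {V₀ B ε : ℝ} (hB : 0 ≤ B) (hε : 0 ≤ ε)
    (hA : 0 ≤ B + amplitude ζ k V₀ ε) {f : L2 k n} (hf : IsH2 f) (i : ℤ) :
    fourierCoeff (diagPart ζ V₀ B ε f) i =
      ((waveNumber k n i ^ 2 / 2 - k ^ 2 / 2 : ℝ) : ℂ) * fourierCoeff f i := by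
  set A := amplitude ζ k V₀ ε with hA'
  have hβ : beta ζ k ε ≠ 0 := by
    rw [beta_eq_kernelSymbol hζ k hε]
    exact (hζ.fourier_pos _).ne'
  have hV : V₀ = -(A * beta ζ k ε) := by
    rw [hA', amplitude]
    field_simp
  have hω : frequency ζ k V₀ B ε = k ^ 2 / 2 + V₀ / 2 + B + A / 2 := by
    rw [frequency, hA', amplitude]
    field_simp
    ring
  have hB' : ((Real.sqrt B : ℝ) : ℂ) ^ 2 = B := by
    rw [← Complex.ofReal_pow, Real.sq_sqrt hB]
  have hA'' : ((Real.sqrt (B + A) : ℝ) : ℂ) ^ 2 = B + A := by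
    rw [← Complex.ofReal_pow, Real.sq_sqrt hA, Complex.ofReal_add]
  have h1 : uSol k n B ^ 2 + vSol ζ k n V₀ B ε ^ 2 =
      (B + A / 2 : ℂ) • 1 + (-(A / 4) : ℂ) • doubleMode k n := by
    rw [uSol, vSol, smul_pow, smul_pow, ← hA', hB', hA'', cosFun_sq, sinFun_sq]
    module
  have h2 : potential k n V₀ + convFun ζ ε (uSol k n B ^ 2 + vSol ζ k n V₀ B ε ^ 2) =
      ((frequency ζ k V₀ B ε - k ^ 2 / 2 : ℝ) : ℂ) • 1 := by
    have hVc : (V₀ : ℂ) = -(A * beta ζ k ε) := by exact_mod_cast hV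
    rw [h1, convFun_doubleMode hζ hε, potential, sinFun_sq, hω]
    push_cast
    rw [hVc]
    module
  have h3 : diagPart ζ V₀ B ε f = -((1 / 2 : ℂ) • secondDeriv f) -
      ((k ^ 2 / 2 : ℝ) : ℂ) • f := by
    have h4 : mulFun (potential k n V₀) f +
        mulFun (convFun ζ ε (uSol k n B ^ 2 + vSol ζ k n V₀ B ε ^ 2)) f =
        ((frequency ζ k V₀ B ε - k ^ 2 / 2 : ℝ) : ℂ) • f := by
      rw [← mulFun_add, h2, mulFun_smul, mulFun_one]
    rw [Complex.ofReal_sub, sub_smul] at h4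
    rw [diagPart, sub_add_eq_add_sub, add_assoc, h4]
    abel
  rw [h3, coeff_sub, coeff_neg, coeff_smul, coeff_smul, coeff_secondDeriv hf]
  push_cast
  ring

theorem coeff_mulFun_uSol (B : ℝ) (f : L2 k n) (i : ℤ) :
    fourierCoeff (mulFun (uSol k n B) f) i =
      Real.sqrt B / 2 * (fourierCoeff f (i - n) + fourierCoeff f (i + n)) := by
  rw [uSol, cosFun_eq, mulFun_smul, mulFun_smul, mulFun_add, coeff_smul, coeff_smul, coeff_add,
    coeff_mulFun_fourier, coeff_mulFun_fourier, sub_neg_eq_add]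
  ring

theorem coeff_mulFun_vSol (V₀ B ε : ℝ) (f : L2 k n) (i : ℤ) :
    fourierCoeff (mulFun (vSol ζ k n V₀ B ε) f) i =
      Real.sqrt (B + amplitude ζ k V₀ ε) * (-Complex.I / 2) *
        (fourierCoeff f (i - n) - fourierCoeff f (i + n)) := by
  have h : (fourier (n : ℤ) - fourier (-(n : ℤ)) : C(Circ k n, ℂ)) =
      fourier (n : ℤ) + (-1 : ℂ) • fourier (-(n : ℤ)) := by
    rw [neg_one_smul, sub_eq_add_neg]
  rw [vSol, sinFun_eq, h, mulFun_smul, mulFun_smul, mulFun_add, mulFun_smul, coeff_smul,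
    coeff_smul, coeff_add, coeff_smul, coeff_mulFun_fourier, coeff_mulFun_fourier, sub_neg_eq_add]
  ring

theorem coeff_convPart (hζ : IsKernelProfile ζ) {V₀ B ε : ℝ} (hε : 0 ≤ ε) (p : L2 k n × L2 k n)
    (i : ℤ) :
    fourierCoeff (convPart ζ V₀ B ε p) i = kernelSymbol ζ (ε * waveNumber k n i) *
      (Real.sqrt B / 2 * (fourierCoeff p.1 (i - n) + fourierCoeff p.1 (i + n)) +
      Real.sqrt (B + amplitude ζ k V₀ ε) * (-Complex.I / 2) *
        (fourierCoeff p.2 (i - n) - fourierCoeff p.2 (i + n))) := by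
  rw [convPart, coeff_conv hζ hε, coeff_add, coeff_mulFun_uSol, coeff_mulFun_vSol]

/-- A function in the Sobolev space of order two with prescribed coefficients on the modes of
wave number `2 k j`. -/
theorem exists_isH2_of_coeff (X : ℤ → ℂ)
    (hX : Summable fun j : ℤ => ((1 + (j : ℝ) ^ 2) * ‖X j‖) ^ 2) :
    ∃ f : L2 k n, IsH2 f ∧ (∀ j, fourierCoeff f (2 * n * j) = X j) ∧
      ∀ i, ¬ (2 * n : ℤ) ∣ i → fourierCoeff f i = 0 := by
  have hn : (2 * n : ℤ) ≠ 0 := by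
    have := NeZero.ne n
    positivity
  set c : ℤ → ℂ := fun i => if (2 * n : ℤ) ∣ i then X (i / (2 * n)) else 0 with hc
  have hcj : ∀ j, c (2 * n * j) = X j := fun j => by
    simp only [hc, if_pos (dvd_mul_right _ _), Int.mul_ediv_cancel_left j hn]
  have hc0 : ∀ i, ¬ (2 * n : ℤ) ∣ i → c i = 0 := fun i hi => if_neg hi
  have hw : ∀ j : ℤ, waveNumber k n (2 * n * j) = 2 * k * j := fun j => by
    rw [mul_right_comm, waveNumber_mul]
    push_cast
    ring
  have hsum : Summable fun i : ℤ => (1 + waveNumber k n i ^ 2) ^ 2 * ‖c i‖ ^ 2 := by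
    refine (Function.Injective.summable_iff (mul_right_injective₀ hn) fun i hi => ?_).mp ?_
    · rw [hc0 i fun ⟨j, hj⟩ => hi ⟨j, hj.symm⟩]
      simp
    -- The constant comes from `1 + (2 k j)² ≤ (1 + 4 k²)(1 + j²)`.
    · refine Summable.of_nonneg_of_le (fun j => mul_nonneg (sq_nonneg _) (sq_nonneg _)) (fun j => ?_)
        (hX.mul_left ((1 + 4 * k ^ 2) ^ 2))
      simp only [Function.comp_apply, hcj, hw]
      rw [mul_pow _ ‖X j‖, ← mul_assoc, ← mul_pow (1 + 4 * k ^ 2)]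
      refine mul_le_mul_of_nonneg_right (pow_le_pow_left₀ (by positivity) ?_ 2) (sq_nonneg _)
      nlinarith [sq_nonneg k, sq_nonneg (j : ℝ)]
  have hmem : Memℓp c 2 := by
    rw [memℓp_gen_iff (by norm_num)]
    refine Summable.of_nonneg_of_le (fun i => by positivity) (fun i => ?_) hsum
    rw [ENNReal.toReal_ofNat, Real.rpow_ofNat]
    refine le_mul_of_one_le_left (by positivity) (one_le_pow₀ ?_)
    nlinarith [sq_nonneg (waveNumber k n i)]
  set f : L2 k n := (fourierBasis (T := period k n)).repr.symm ⟨c, hmem⟩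
  have hf : ∀ i, fourierCoeff f i = c i := fun i => by
    rw [← fourierBasis_repr, LinearIsometryEquiv.apply_symm_apply]
  refine ⟨f, ?_, fun j => by rw [hf, hcj], fun i hi => by rw [hf, hc0 i hi]⟩
  simpa only [IsH2, hf] using hsum

/-- A nonzero element of the kernel of `op - lam` in the domain places `lam` in the spectrum. -/
theorem not_isResolventPoint_of_eigenvector {X : Type*} [NormedAddCommGroup X] [NormedSpace ℂ X]
    {dom : Set X} {op : X → X} {lam : ℂ} {f : X} (hf : f ∈ dom) (h : op f = lam • f)
    (hne : f ≠ 0) : ¬ IsResolventPoint dom op lam := by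
  rintro ⟨S, -, hS⟩
  have := hS f hf
  rw [h, sub_self, map_zero] at this
  exact hne this.symm

/-- Recombines the parity blocks: the even and odd parts of `x` hold the cosine coefficients of `z`
and the sine coefficients of `w`, and `y` holds the opposite parities. Here `q = √B` and `c = √(B +
A)`, so that `a = (c + q)/2` and `b = (c - q)/2`. -/
theorem seqL_modes {k q c t : ℝ} {r x y : ℤ → ℝ} (hrs : ∀ j, r (-1 - j) = r j)
    (hx : ∀ j, seqL k ((c + q) / 2) ((c - q) / 2) 1 r x j = t * y j)
    (hy : ∀ j, seqL k ((c + q) / 2) ((c - q) / 2) (-1) r y j = -(t * x j)) {W Z G : ℤ → ℂ}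
    (hW : ∀ j, W j = (y j + y (-j)) / 2 - Complex.I * ((x j - x (-j)) / 2))
    (hZ : ∀ j, Z j = (x j + x (-j)) / 2 + Complex.I * ((y j - y (-j)) / 2))
    (hG : ∀ j, G j = r j * (q / 2 * (W j + W (j + 1)) +
      c * (-Complex.I / 2) * (Z j - Z (j + 1)))) (j : ℤ) :
    symbol k j * Z j + c * (-Complex.I) * (G (j - 1) - G j) = t * W j ∧
      symbol k j * W j + q * (G (j - 1) + G j) = -(t * Z j) := by
  have hr1 : r (-j) = r (j - 1) := by
    rw [← hrs (j - 1), show -1 - (j - 1) = -j by ring]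
  have hr2 : r (-j - 1) = r j := by
    rw [← hrs j, show -j - 1 = -1 - j by ring]
  have hs : symbol k (-j) = symbol k j := by
    rw [symbol, symbol]
    push_cast
    ring
  have hx1 := hx j
  have hx2 := hx (-j)
  have hy1 := hy j
  have hy2 := hy (-j)
  simp only [seqL, hr1, hr2, hs, neg_neg, sub_neg_eq_add, show -1 - j = -j - 1 by ring,
    show -1 + j = j - 1 by ring, show -j + 1 = 1 - j by ring, show 1 + j = j + 1 by ring]
    at hx1 hx2 hy1 hy2
  have hx1' := congrArg (fun s : ℝ => (s : ℂ)) hx1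
  have hx2' := congrArg (fun s : ℝ => (s : ℂ)) hx2
  have hy1' := congrArg (fun s : ℝ => (s : ℂ)) hy1
  have hy2' := congrArg (fun s : ℝ => (s : ℂ)) hy2
  push_cast at hx1' hx2' hy1' hy2'
  simp only [hG, hW, hZ, sub_add_cancel, show -(j + 1) = -j - 1 by ring,
    show -(j - 1) = 1 - j by ring]
  have h3 : Complex.I ^ 3 = -Complex.I := by
    rw [pow_succ, Complex.I_sq]
    ring
  constructor
  · linear_combination (norm := (ring_nf; simp only [Complex.I_sq, h3]; ring))
      (1 / 2) * hx1' + (1 / 2) * hx2' + (Complex.I / 2) * (hy1' - hy2')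
  · linear_combination (norm := (ring_nf; simp only [Complex.I_sq]; ring))
      (1 / 2) * hy1' + (1 / 2) * hy2' - (Complex.I / 2) * (hx1' - hx2')

end Linearization

/-- The values `s = I` and `s = -I` cover the coefficients of `z` and of `w` respectively. -/
theorem summable_modes {x y : ℤ → ℝ} (s : ℂ) (hs : ‖s‖ = 1)
    (hx : Summable fun j : ℤ => ((1 + (j : ℝ) ^ 2) * x j) ^ 2)
    (hy : Summable fun j : ℤ => ((1 + (j : ℝ) ^ 2) * y j) ^ 2) :
    Summable fun j : ℤ => ((1 + (j : ℝ) ^ 2) *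
      ‖((x j + x (-j)) / 2 + s * ((y j - y (-j)) / 2) : ℂ)‖) ^ 2 := by
  have hx' := (Equiv.neg ℤ).summable_iff.mpr hx
  have hy' := (Equiv.neg ℤ).summable_iff.mpr hy
  refine Summable.of_nonneg_of_le (fun j => sq_nonneg _) (fun j => ?_)
    ((hx.add hx').add (hy.add hy'))
  simp only [Function.comp_apply, Equiv.neg_apply, Int.cast_neg, neg_sq, mul_pow, ← mul_add]
  refine mul_le_mul_of_nonneg_left ?_ (sq_nonneg _)
  have h1 : ‖((x j + x (-j)) / 2 + s * ((y j - y (-j)) / 2) : ℂ)‖ ≤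
      |(x j + x (-j)) / 2| + |(y j - y (-j)) / 2| := by
    refine (norm_add_le _ _).trans (le_of_eq ?_)
    rw [norm_mul, hs, one_mul, ← Real.norm_eq_abs, ← Real.norm_eq_abs, ← Complex.norm_real,
      ← Complex.norm_real]
    push_cast
    rfl
  refine (pow_le_pow_left₀ (norm_nonneg _) h1 2).trans ?_
  have h2 := sq_abs ((x j + x (-j)) / 2)
  have h3 := sq_abs ((y j - y (-j)) / 2)
  nlinarith [sq_nonneg (|(x j + x (-j)) / 2| - |(y j - y (-j)) / 2|), sq_nonneg (x j - x (-j)),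
    sq_nonneg (y j + y (-j))]

/-! ### The unstable eigenfunction on the circle -/

variable {k : ℝ} [hk : Fact (0 < k)] {n : ℕ} [NeZero n] {ζ : ℝ → ℝ}

/-- The linearization has a positive eigenvalue if the convolution acts on the first mode with a
factor at least `1 / 2`. -/
theorem exists_pos_eigenvalue (hζ : IsKernelProfile ζ) {V₀ B ε : ℝ} (hB : 0 ≤ B)
    (hBk : B ≤ k ^ 2 / 4) (hε : 0 ≤ ε) (hA : 2.46 * k ^ 2 ≤ amplitude ζ k V₀ ε)
    (hr : 1 / 2 ≤ kernelSymbol ζ (ε * k)) :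
    ∃ t : ℝ, 0 < t ∧ ∃ p : L2 k n × L2 k n, p ≠ 0 ∧ (IsH2 p.1 ∧ IsH2 p.2) ∧
      opJL ζ V₀ B ε p = (t : ℂ) • p := by
  have hk0 : 0 < k := hk.out
  have hk2 : 0 < k ^ 2 := by positivity
  have hBA : 0 ≤ B + amplitude ζ k V₀ ε := by linarith
  set q := Real.sqrt B with hq
  set c := Real.sqrt (B + amplitude ζ k V₀ ε) with hc
  have hq2 : q ^ 2 = B := Real.sq_sqrt hB
  have hc2 : c ^ 2 = B + amplitude ζ k V₀ ε := Real.sq_sqrt hBA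
  -- Multiplying by `u` or `v` shifts wave numbers by `±k`, so the convolution acts only on the odd
  -- multiples `k(2j + 1)`.
  set r : ℤ → ℝ := fun j => kernelSymbol ζ (ε * (k * (2 * j + 1))) with hr'
  have hrs : ∀ j, r (-1 - j) = r j := fun j => by
    simp only [hr']
    rw [← kernelSymbol_neg hζ.even]
    congr 1
    push_cast
    ring
  obtain ⟨t, ht, x, y, hy0, hx, hy, hxs, hys⟩ := exists_eigenSequence (k := k) (r := r) (c := c)
    (a := (c + q) / 2) (b := (c - q) / 2) hk0 (by linarith) (by ring)
    (by rw [show (c + q) / 2 - (c - q) / 2 = q by ring, hq2]; exact hBk)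
    (fun j => (hζ.fourier_pos _).le) (fun j => kernelSymbol_le_one hζ _) hrs
    (by simpa [hr'] using hr)
  set W : ℤ → ℂ := fun j => (y j + y (-j)) / 2 - Complex.I * ((x j - x (-j)) / 2) with hW
  set Z : ℤ → ℂ := fun j => (x j + x (-j)) / 2 + Complex.I * ((y j - y (-j)) / 2) with hZ
  set G : ℤ → ℂ := fun j => r j * (q / 2 * (W j + W (j + 1)) +
      c * (-Complex.I / 2) * (Z j - Z (j + 1))) with hG
  have hmodes := seqL_modes (W := W) (Z := Z) (G := G) hrs hx hy (fun _ => rfl) (fun _ => rfl)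
    (fun _ => rfl)
  obtain ⟨w, hw2, hwj, hw0⟩ := exists_isH2_of_coeff (k := k) (n := n) W
    (by simpa only [hW, neg_mul, ← sub_eq_add_neg] using
      summable_modes (-Complex.I) (by simp) hys hxs)
  obtain ⟨z, hz2, hzj, hz0⟩ := exists_isH2_of_coeff (k := k) (n := n) Z
    (summable_modes Complex.I (by simp) hxs hys)
  have hgj : ∀ j : ℤ, fourierCoeff (convPart ζ V₀ B ε (w, z)) (n * (2 * j + 1)) = G j := fun j => by
    rw [coeff_convPart hζ hε, show (n * (2 * j + 1) - n : ℤ) = 2 * n * j by ring,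
      show (n * (2 * j + 1) + n : ℤ) = 2 * n * (j + 1) by ring, hwj, hwj, hzj, hzj,
      mul_comm (n : ℤ), waveNumber_mul]
    simp only [hG, hr']
    push_cast
    rfl
  have hg0 : ∀ i : ℤ, ¬ (2 * n : ℤ) ∣ i - n → fourierCoeff (convPart ζ V₀ B ε (w, z)) i = 0 :=
    fun i hi => by
      have hi' : ¬ (2 * n : ℤ) ∣ i + n := fun h => hi (by
        have := dvd_sub h (dvd_refl (2 * n : ℤ))
        rwa [show i + n - 2 * n = i - (n : ℤ) by ring] at this)
      rw [coeff_convPart hζ hε, hw0 _ hi, hw0 _ hi', hz0 _ hi, hz0 _ hi']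
      ring
  have hsym : ∀ j : ℤ, waveNumber k n (2 * n * j) ^ 2 / 2 - k ^ 2 / 2 = symbol k j := fun j => by
    rw [mul_right_comm, waveNumber_mul, symbol]
    push_cast
    ring
  have hL1 : (opL ζ V₀ B ε (w, z)).1 = -((t : ℂ) • z) := coeff_ext fun i => by
    rw [opL, coeff_add, coeff_diagPart hζ hB hε hBA hw2, coeff_smul, coeff_mulFun_uSol, coeff_neg,
      coeff_smul]
    by_cases hi : (2 * n : ℤ) ∣ i
    · obtain ⟨j, rfl⟩ := hi
      rw [hsym, hwj, hzj, show (2 * n * j - n : ℤ) = n * (2 * (j - 1) + 1) by ring,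
        show (2 * n * j + n : ℤ) = n * (2 * j + 1) by ring, hgj, hgj]
      linear_combination (hmodes j).2
    · have hi' : ¬ (2 * n : ℤ) ∣ i - n - n := fun h => hi (by
        have := dvd_add h (dvd_refl (2 * n : ℤ))
        rwa [show i - n - n + 2 * n = (i : ℤ) by ring] at this)
      rw [hw0 _ hi, hz0 _ hi, hg0 _ hi', hg0 (i + n) (by rwa [add_sub_cancel_right])]
      ring
  have hL2 : (opL ζ V₀ B ε (w, z)).2 = (t : ℂ) • w := coeff_ext fun i => by
    rw [opL, coeff_add, coeff_diagPart hζ hB hε hBA hz2, coeff_smul, coeff_mulFun_vSol, coeff_smul]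
    by_cases hi : (2 * n : ℤ) ∣ i
    · obtain ⟨j, rfl⟩ := hi
      rw [hsym, hwj, hzj, show (2 * n * j - n : ℤ) = n * (2 * (j - 1) + 1) by ring,
        show (2 * n * j + n : ℤ) = n * (2 * j + 1) by ring, hgj, hgj]
      linear_combination (hmodes j).1
    · have hi' : ¬ (2 * n : ℤ) ∣ i - n - n := fun h => hi (by
        have := dvd_add h (dvd_refl (2 * n : ℤ))
        rwa [show i - n - n + 2 * n = (i : ℤ) by ring] at this)
      rw [hw0 _ hi, hz0 _ hi, hg0 _ hi', hg0 (i + n) (by rwa [add_sub_cancel_right])]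
      ring
  -- Nonvanishing follows from `y j = Re (W j) + Im (Z j)`.
  refine ⟨t, ht, (w, z), fun h => hy0 ?_, ⟨hw2, hz2⟩, ?_⟩
  · have hwz := Prod.ext_iff.mp h
    have hzero : ∀ i, fourierCoeff (0 : L2 k n) i = 0 := fun i => by
      rw [coeff_eq_inner, inner_zero_right]
    refine lp.ext (funext fun j => ?_)
    have h1 := congrArg Complex.re (hwj j)
    have h2 := congrArg Complex.im (hzj j)
    rw [show w = 0 from hwz.1, hzero] at h1
    rw [show z = 0 from hwz.2, hzero] at h2
    have h3 : (W j).re = (y j + y (-j)) / 2 := by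
      have : W j = (((y j + y (-j)) / 2 : ℝ) : ℂ) +
          ((-((x j - x (-j)) / 2) : ℝ) : ℂ) * Complex.I := by
        simp only [hW]
        push_cast
        ring
      rw [this, Complex.add_re, Complex.re_ofReal_mul, Complex.I_re, mul_zero, add_zero,
        Complex.ofReal_re]
    have h4 : (Z j).im = (y j - y (-j)) / 2 := by
      have : Z j = (((x j + x (-j)) / 2 : ℝ) : ℂ) +
          (((y j - y (-j)) / 2 : ℝ) : ℂ) * Complex.I := by
        simp only [hZ]
        push_cast
        ring
      rw [this, Complex.add_im, Complex.im_ofReal_mul, Complex.I_im, mul_one, Complex.ofReal_im,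
        zero_add]
    rw [h3, Complex.zero_re] at h1
    rw [h4, Complex.zero_im] at h2
    change y j = 0
    linarith
  · rw [opJL, hL1, hL2, neg_neg]
    rfl

end

end NonlocalGP

theorem theorem4 (ζ : ℝ → ℝ) (hζ : NonlocalGP.IsKernelProfile ζ) (k : ℝ) [Fact (0 < k)]
    (A₁ : ℝ) :
    ∃ δ : ℝ, 0 < δ ∧ ∀ V₀ B ε : ℝ, 0 ≤ B → B < δ → 0 ≤ ε → ε < δ →
      2.46 * k ^ 2 ≤ NonlocalGP.amplitude ζ k V₀ ε → NonlocalGP.amplitude ζ k V₀ ε ≤ A₁ →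
      ∀ (n : ℕ) [NeZero n], ¬ NonlocalGP.SpectrallyStable ζ k V₀ B ε n := by
  have hk : 0 < k := Fact.out
  have hcont : Continuous fun ε : ℝ => NonlocalGP.kernelSymbol ζ (ε * k) :=
    (NonlocalGP.continuous_kernelSymbol hζ.integrable).comp (continuous_mul_const k)
  have hev : ∀ᶠ ε in nhds (0 : ℝ), 1 / 2 < NonlocalGP.kernelSymbol ζ (ε * k) := by
    refine hcont.continuousAt.eventually_const_lt ?_
    change 1 / 2 < NonlocalGP.kernelSymbol ζ (0 * k)
    rw [zero_mul, NonlocalGP.kernelSymbol_zero hζ.integral_eq_one]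
    norm_num
  obtain ⟨δ, hδ, hδε⟩ := Metric.eventually_nhds_iff.mp hev
  -- The first bound keeps the symbol at wave number `k` above `1 / 2`, as `L₊` requires; the second
  -- keeps the constant mode of `L₋` negative. Neither depends on `n`.
  refine ⟨min δ (k ^ 2 / 4), lt_min hδ (by positivity), ?_⟩
  intro V₀ B ε hB hBδ hε hεδ hA _ n _ hst
  obtain ⟨t, ht, p, hp0, hp2, hp⟩ := NonlocalGP.exists_pos_eigenvalue (n := n) hζ hB
    (hBδ.le.trans (min_le_right _ _)) hε hA
    (hδε (by rw [Real.dist_eq, sub_zero, abs_of_nonneg hε]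
             exact hεδ.trans_le (min_le_left _ _))).le
  have := hst t (NonlocalGP.not_isResolventPoint_of_eigenvector hp2 hp hp0)
  rw [Complex.ofReal_re] at this
  exact this.not_gt ht
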